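/- Let $n\ge 1$, let $X=\mathbb{CP}^{n-1}$ be the space of complex lines in $\mathbb C^n$, and let $L$ be the dual of the tautological line bundle, with the Hermitian metric $h^L$ induced by the standard Hermitian product of $\mathbb C^n$ and its Chern connection $\nabla^L$. For $m\in\mathbb Z$, the sections of $L^m$ over a subset $Y\subset X$ are the functions on the cone over $Y$ in $\mathbb C^n\setminus\{0\}$ that are homogeneous of degree $m$. Equip $X$ with the Kähler metric of the form $\omega=\frac{\sqrt{-1}}{2\pi}R^L$ (so that projective lines have area $1$), with Riemannian volume $dv_X$. Let $P_m(x,y)\in L^m_x\otimes (L^m_y)^*$ be the Bergman kernel of $L^m$, that is, the smooth kernel, with respect to $dv_X$, of the $L^2$-orthogonal projection onto the space $H^0(X,L^m)$ of holomorphic sections. The group $U(n)$ acts on $X$ by $g[z]=[\bar g z]$, on $L^m$ by $(g\varphi)(w)=\varphi(\bar g^{-1}w)$, and on sections by $(gs)(x)=g.s(g^{-1}x)$. Thus it acts on homogeneous polynomials of degree $m\geq 0$ by $(gF)(z)=F(g^{T}z)$, and $V(m\lambda):=H^0(X,L^m)$ is then the irreducible representation of highest weight $m\lambda=(m,0,\dots,0)$.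 Let $T_0\subset U(n)$ be the torus of the matrices $e^{\xi}=\mathrm{diag}(1,e^{2\pi\sqrt{-1}\xi_2},\dots,e^{2\pi\sqrt{-1}\xi_n})$, $\xi\in\mathbb R^{n-1}$. For $\nu\in\mathbb R^{n-1}$ let $$\mathbb C_\nu=\{u\in V(m\lambda) : e^{\xi}.u=e^{2\pi\sqrt{-1}\langle\nu,\xi\rangle}u\ \text{ for all }\xi\in\mathbb R^{n-1}\},$$ and let $\Gamma_m=\{\nu\in\mathbb Z^{n-1} : \mathbb C_\nu\neq 0\}$ be the set of weights. Let $\mu_0:X\to\mathbb R^{n-1}$, $\mu_0([z])=(|z_2|^2,\dots,|z_n|^2)/|z|^2$, be the moment map of $T_0$, with fibres $\Lambda_\nu=\mu_0^{-1}(\nu)$. Each nonempty fibre is a submanifold of $X$; let $dv_{\Lambda_\nu}$ be its Riemannian volume for the metric induced from $X$. **Proposition 4.3.** Let $p\ge 1$ and $k\ge 0$ be integers and let $v_p\in\frac1p\Gamma_{p-k}$. Let $f$ be a smooth section of $L^{-k}$ over $\Lambda_{v_p}$ that is invariant under $T_0$, and let $\zeta^p$ be a smooth section of $L^p$ over $\Lambda_{v_p}$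 with $\nabla\zeta^p\equiv 0$ along $\Lambda_{v_p}$. Then the integral $$s_{\Lambda_{v_p}}(x)=\int_{\Lambda_{v_p}}P_{p-k}(x,y).\zeta^pf(y)\,dv_{\Lambda_{v_p}}(y)$$ converges for every $x\in X$, and it defines a holomorphic section $s_{\Lambda_{v_p}}\in H^0(X,L^{p-k})$ that belongs to $\mathbb C_{pv_p}\subset V((p-k)\lambda)$. Furthermore, if $\zeta^p\neq0$ and $f\neq0$, then $s_{\Lambda_{v_p}}\neq0$. -/

import Mathlib

open MeasureTheory
open scoped ContDiff LinearAlgebra.Projectivization Matrix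

noncomputable section

namespace CPQuant

/-! Throughout, `d = n - 1` is the complex dimension of `X = ℂℙ^{n-1}`, and homogeneous coordinates
`z₁, …, z_n` are indexed by `Fin (d + 1)`; `z₁` is the coordinate of index `0`. -/

/-- `ℂⁿ` with its standard Hermitian product. -/
abbrev E (d : ℕ) : Type := EuclideanSpace ℂ (Fin (d + 1))

/-- Complex projective space: complex lines in `ℂⁿ`. -/
abbrev CP (d : ℕ) : Type := ℙ ℂ (E d)

/-- The unitary group `U(n)`. -/
abbrev U (d : ℕ) : Type := ↥(Matrix.unitaryGroup (Fin (d + 1)) ℂ)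

variable {d : ℕ}

/-! ### Riemannian structure and volumes -/

/-- The matrix of the orthogonal projection of `ℂⁿ` onto the line `x`, scaled by `1/√(2π)`.
A tangent vector `w ⊥ z` at `x = [z]`, `|z| = 1`, is sent to `(w z* + z w*)/√(2π)`, which has square
Hilbert-Schmidt norm `|w|²/π`. Hence this is an isometric embedding of `(X, g)`, where
`g = ω(·, J·)` and `ω = (i/2π) ∂∂̄ log |z|²` is the Fubini-Study form, which is the curvature form
of the dual of the tautological bundle and gives area `1` to projective lines. -/
def projEmb (x : CP d) : EuclideanSpace ℂ (Fin (d + 1) × Fin (d + 1)) :=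
  WithLp.toLp 2 fun ij =>
    ((1 / Real.sqrt (2 * Real.pi) : ℝ) : ℂ) *
      (x.rep ij.1 * (starRingEnd ℂ) (x.rep ij.2) / ((‖x.rep‖ ^ 2 : ℝ) : ℂ))

theorem projEmb_injective : Function.Injective (projEmb (d := d)) := by
  intro x y hxy
  have hpi : ((1 / Real.sqrt (2 * Real.pi) : ℝ) : ℂ) ≠ 0 := by
    have : (0 : ℝ) < 1 / Real.sqrt (2 * Real.pi) := by positivity
    exact_mod_cast this.ne'
  have hent : ∀ i j, x.rep i * (starRingEnd ℂ) (x.rep j) / ((‖x.rep‖ ^ 2 : ℝ) : ℂ)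
      = y.rep i * (starRingEnd ℂ) (y.rep j) / ((‖y.rep‖ ^ 2 : ℝ) : ℂ) := by
    intro i j
    have := congrArg (fun u => u (i, j)) hxy
    exact mul_left_cancel₀ hpi this
  have hy0 : y.rep ≠ 0 := y.rep_nonzero
  have hx0 : x.rep ≠ 0 := x.rep_nonzero
  obtain ⟨j, hj⟩ : ∃ j, y.rep j ≠ 0 := by
    by_contra hcon
    push Not at hcon
    exact hy0 (by ext j; simpa using hcon j)
  have hnx : ((‖x.rep‖ ^ 2 : ℝ) : ℂ) ≠ 0 := by
    have : (0 : ℝ) < ‖x.rep‖ ^ 2 := by positivity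
    exact_mod_cast this.ne'
  have hny : ((‖y.rep‖ ^ 2 : ℝ) : ℂ) ≠ 0 := by
    have : (0 : ℝ) < ‖y.rep‖ ^ 2 := by positivity
    exact_mod_cast this.ne'
  have hsj : (starRingEnd ℂ) (y.rep j) ≠ 0 := by simpa using hj
  rw [← x.mk_rep, ← y.mk_rep, eq_comm, Projectivization.mk_eq_mk_iff']
  refine ⟨((starRingEnd ℂ) (x.rep j) / ((‖x.rep‖ ^ 2 : ℝ) : ℂ)) *
    (((‖y.rep‖ ^ 2 : ℝ) : ℂ) / (starRingEnd ℂ) (y.rep j)), ?_⟩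
  ext i
  have h := hent i j
  rw [PiLp.smul_apply, smul_eq_mul]
  generalize ((‖x.rep‖ ^ 2 : ℝ) : ℂ) = a at *
  generalize ((‖y.rep‖ ^ 2 : ℝ) : ℂ) = b at *
  generalize (starRingEnd ℂ) (y.rep j) = c at *
  generalize (starRingEnd ℂ) (x.rep j) = e at *
  field_simp at h ⊢
  linear_combination h

/-- The distance induced by the isometric embedding `projEmb`. -/
instance : MetricSpace (CP d) := MetricSpace.induced projEmb projEmb_injective inferInstance

instance : MeasurableSpace (CP d) := borel _

instance : BorelSpace (CP d) := ⟨rfl⟩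

/-- The Riemannian (equivalently, Liouville) volume `dv_X`. For a submanifold of dimension `ℓ` of
a Euclidean space, the Riemannian volume of the induced metric is the `ℓ`-dimensional Hausdorff
measure, in the normalization of Lebesgue measure. -/
def volX (d : ℕ) : Measure (CP d) := μHE[2 * d]

/-! ### The line bundles `L^m`, `m ∈ ℤ`, for `L` the dual of the tautological line bundle -/

/-- The fibre of `L^m` at the line `x ∈ ℂℙ^{n-1}`: the functions on `x ∖ {0}` that are homogeneous
of degree `m` (extended by zero to `ℂⁿ`). For `m = 1` these are the linear forms on `x`; for
negative `m` this is the fibre of the dual of `L^{-m}`. -/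
def Fib (m : ℤ) (x : CP d) : Submodule ℂ (E d → ℂ) where
  carrier := {φ | (∀ c : ℂ, c ≠ 0 → ∀ v, φ (c • v) = c ^ m * φ v) ∧
    ∀ v, φ v ≠ 0 → v ≠ 0 ∧ v ∈ x.submodule}
  zero_mem' := by simp
  add_mem' := by
    rintro φ ψ ⟨h1, h2⟩ ⟨h3, h4⟩
    refine ⟨fun c hc v => by simp [h1 c hc, h3 c hc, mul_add], fun v hv => ?_⟩
    by_cases h : φ v = 0
    · exact h4 v fun h' => hv (by simp [h, h'])
    · exact h2 v h
  smul_mem' := by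
    rintro a φ ⟨h1, h2⟩
    refine ⟨fun c hc v => ?_, fun v hv => h2 v fun h => hv (by simp [h])⟩
    simp only [Pi.smul_apply, smul_eq_mul, h1 c hc]
    ring

/-- The tensor product `L^a_x ⊗ L^b_x → L^{a+b}_x`. -/
def tensor {a b : ℤ} {x : CP d} (φ : Fib a x) (ψ : Fib b x) : Fib (a + b) x :=
  ⟨fun v => φ.1 v * ψ.1 v, by
    refine ⟨fun c hc v => ?_, fun v hv => φ.2.2 v (left_ne_zero_of_mul hv)⟩
    change φ.1 (c • v) * ψ.1 (c • v) = c ^ (a + b) * (φ.1 v * ψ.1 v)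
    rw [φ.2.1 c hc, ψ.2.1 c hc, zpow_add₀ hc]
    ring⟩

/-- The Hermitian metric of `L^m` induced by the standard Hermitian product of `ℂⁿ`,
`h(φ, ψ) = φ(z) conj(ψ(z)) / |z|^{2m}` for any nonzero `z ∈ x`. -/
def herm {m : ℤ} {x : CP d} (φ ψ : Fib m x) : ℂ :=
  φ.1 x.rep * (starRingEnd ℂ) (ψ.1 x.rep) / ((‖x.rep‖ ^ (2 * m) : ℝ) : ℂ)

/-- The integral of a function with values in the complex line `L^m_x`. -/
def fibIntegral {α : Type*} [MeasurableSpace α] {m : ℤ} {x : CP d} (μ : Measure α)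
    (g : α → Fib m x) : Fib m x :=
  ⟨fun v => ∫ a, (g a).1 v ∂μ, by
    refine ⟨fun c hc v => ?_, fun v hv => ?_⟩
    · rw [← integral_const_mul]
      exact integral_congr_ae (Filter.Eventually.of_forall fun a => (g a).2.1 c hc v)
    · by_contra hcon
      refine hv ?_
      have : ∀ a, (g a).1 v = 0 := fun a => by
        by_contra h
        exact hcon ((g a).2.2 v h)
      simp [this]⟩

/-! ### Sections -/

/-- The cone over a subset `Y` of projective space, its preimage under `ℂⁿ ∖ {0} → ℂℙ^{n-1}`. -/
def cone (Y : Set (CP d)) : Set (E d) := {v | ∃ hv : v ≠ 0, Projectivization.mk ℂ v hv ∈ Y}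

/-- Sections of `L^m` over `X`. -/
abbrev Sec (d : ℕ) (m : ℤ) : Type := ∀ x : CP d, Fib m x

/-- Sections of `L^m` over a subset `Y` of `X`. -/
abbrev SecOn (m : ℤ) (Y : Set (CP d)) : Type := ∀ y : Y, Fib m (y : CP d)

/-- The homogeneous function `v ↦ s([v])(v)` on `ℂⁿ ∖ {0}` given by a section of `L^m`. -/
def lift {m : ℤ} (s : Sec d m) (v : E d) : ℂ :=
  open Classical in if hv : v ≠ 0 then (s (Projectivization.mk ℂ v hv)).1 v else 0

/-- The homogeneous function `v ↦ s([v])(v)` on the cone over `Y` given by a section over `Y`. -/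
def liftOn {m : ℤ} {Y : Set (CP d)} (s : SecOn m Y) (v : E d) : ℂ :=
  open Classical in
  if hv : ∃ hv : v ≠ 0, Projectivization.mk ℂ v hv ∈ Y then (s ⟨_, hv.choose_spec⟩).1 v else 0

/-- Smooth sections over `X`. -/
def IsSmooth {m : ℤ} (s : Sec d m) : Prop := ContDiffOn ℝ ∞ (lift s) {0}ᶜ

/-- Smooth sections over a submanifold `Y` of `X`: the function on the cone over `Y` (a submanifold
of `ℂⁿ ∖ {0}`) extends smoothly near each of its points. -/
def IsSmoothOn {m : ℤ} {Y : Set (CP d)} (s : SecOn m Y) : Prop :=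
  ∀ v ∈ cone Y, ∃ W : Set (E d), IsOpen W ∧ v ∈ W ∧ ∃ G : E d → ℂ, ContDiffOn ℝ ∞ G W ∧
    ∀ w ∈ W ∩ cone Y, G w = liftOn s w

/-- The covariant derivative `∇_{γ'} s` along the curve `t ↦ [γ(t)]` for the Chern (Fubini-Study)
connection of `L^m`, evaluated at `γ(t) ∈ [γ(t)]`, where `F` is the homogeneous function given by
the section `s`. It is `dF` on the horizontal vectors `⟨v, u⟩ = 0`, which are lifts of the tangent
vectors of `X`. -/
def covDeriv (m : ℤ) (F : E d → ℂ) (γ : ℝ → E d) (t : ℝ) : ℂ :=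
  deriv (fun τ => F (γ τ)) t
    - (m : ℂ) * (inner ℂ (γ t) (deriv γ t) / ((‖γ t‖ ^ 2 : ℝ) : ℂ)) * F (γ t)

/-- `∇ s = 0` for a smooth section `s` over a submanifold `Y`: the covariant derivative vanishes
along all smooth curves in `Y`. -/
def IsFlatOn {m : ℤ} {Y : Set (CP d)} (s : SecOn m Y) : Prop :=
  ∀ γ : ℝ → E d, ContDiff ℝ ∞ γ → (∀ t, γ t ∈ cone Y) → ∀ t, covDeriv m (liftOn s) γ t = 0

/-- The space `H⁰(X, L^m)` of holomorphic sections. -/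
def H0 (d : ℕ) (m : ℤ) : Submodule ℂ (Sec d m) where
  carrier := {s | DifferentiableOn ℂ (lift s) {0}ᶜ}
  zero_mem' := by
    have : lift (0 : Sec d m) = fun _ => 0 := by
      funext v
      simp [lift]
    simp only [Set.mem_ofPred_eq, this]
    exact differentiableOn_const 0
  add_mem' := by
    intro s t hs ht
    have : lift (s + t) = fun v => lift s v + lift t v := by
      funext v
      by_cases hv : v = 0 <;> simp [lift, hv]
    simp only [Set.mem_ofPred_eq, this] at *
    exact hs.fun_add ht
  smul_mem' := by
    intro a s hs
    have : lift (a • s) = fun v => a * lift s v := by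
      funext v
      by_cases hv : v = 0 <;> simp [lift, hv]
    simp only [Set.mem_ofPred_eq, this] at *
    exact hs.const_mul a

/-- The `L²`-Hermitian product of sections. -/
def innerL2 {m : ℤ} (s t : Sec d m) : ℂ := ∫ x, herm (s x) (t x) ∂(volX d)

/-! ### The Bergman kernel -/

/-- Schwartz kernels on `X` for sections of `L^m`: `P(x, y) ∈ L^m_x ⊗ (L^m_y)^*`. -/
abbrev Ker (d : ℕ) (m : ℤ) : Type := ∀ x y : CP d, Fib m y →ₗ[ℂ] Fib m x

/-- `(P s)(x) = ∫_X P(x, y).s(y) dv_X(y)`. -/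
def Ker.op {m : ℤ} (P : Ker d m) (s : Sec d m) : Sec d m :=
  fun x => fibIntegral (volX d) fun y => P x y (s y)

/-- `P` is smooth: it is given by a smooth function on `(ℂⁿ ∖ {0})²`. -/
def Ker.Smooth {m : ℤ} (P : Ker d m) : Prop :=
  ∃ K : E d × E d → ℂ, ContDiffOn ℝ ∞ K {q | q.1 ≠ 0 ∧ q.2 ≠ 0} ∧
    ∀ (v w : E d) (hv : v ≠ 0) (hw : w ≠ 0) (φ : Fib m (Projectivization.mk ℂ w hw)),
      (P (Projectivization.mk ℂ v hv) (Projectivization.mk ℂ w hw) φ).1 v = K (v, w) * φ.1 w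

/-- `P` is the smooth Schwartz kernel of the orthogonal projection of `L²(X, L^m)` onto
`H⁰(X, L^m)`: for every smooth section `s`, the section `P s` is holomorphic and `s - P s` is
orthogonal to all holomorphic sections. -/
def IsBergmanKernel (m : ℤ) (P : Ker d m) : Prop :=
  P.Smooth ∧ ∀ s : Sec d m, IsSmooth s →
    P.op s ∈ H0 d m ∧ ∀ t ∈ H0 d m, innerL2 (P.op s) t = innerL2 s t

/-- The Bergman kernel of `L^m`, the unique kernel with the property `IsBergmanKernel`. -/
def bergman (d : ℕ) (m : ℤ) : Ker d m := Classical.epsilon (IsBergmanKernel m)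

/-! ### The action of `U(n)`

The unitary group acts on `ℂⁿ` by `z ↦ ḡ z`, so that the induced action on linear forms (that is,
on `H⁰(X, L)`) is the standard representation of `U(n)`, and `H⁰(X, L^m)` is the irreducible
representation `V(mλ)` of highest weight `(m, 0, …, 0)`. The coadjoint orbit of rank one projections
`Π_z` is identified, equivariantly and biholomorphically, to `ℂℙ^{n-1}` by `Π_z ↦ [z̄]`. -/

/-- The linear map `z ↦ ḡ z`. -/
def cj (g : U d) : E d →ₗ[ℂ] E d := Matrix.toEuclideanLin (g.1.map (starRingEnd ℂ))

theorem cj_one : cj (1 : U d) = LinearMap.id := by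
  ext v i
  simp [cj]

theorem cj_mul (g h : U d) (v : E d) : cj (g * h) v = cj g (cj h v) := by
  simp [cj, Matrix.map_mul]

theorem cj_inv_cj (g : U d) (v : E d) : cj g⁻¹ (cj g v) = v := by
  rw [← cj_mul, inv_mul_cancel, cj_one]
  rfl

theorem cj_cj_inv (g : U d) (v : E d) : cj g (cj g⁻¹ v) = v := by
  rw [← cj_mul, mul_inv_cancel, cj_one]
  rfl

theorem cj_injective (g : U d) : Function.Injective (cj g) :=
  Function.LeftInverse.injective (cj_inv_cj g)

/-- The action of `U(n)` on `ℂℙ^{n-1}`. -/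
def actX (g : U d) (x : CP d) : CP d := Projectivization.map (cj g) (cj_injective g) x

theorem actX_mk (g : U d) (v : E d) (hv : v ≠ 0) (hv' : cj g v ≠ 0) :
    actX g (Projectivization.mk ℂ v hv) = Projectivization.mk ℂ (cj g v) hv' := rfl

theorem actX_one (x : CP d) : actX 1 x = x := by
  induction x using Projectivization.ind with
  | h v hv =>
    have h : cj (1 : U d) v = v := by rw [cj_one]; rfl
    rw [actX_mk 1 v hv (by rwa [h])]
    simp only [h]

theorem actX_mul (g h : U d) (x : CP d) : actX (g * h) x = actX g (actX h x) := by
  induction x using Projectivization.ind with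
  | h v hv =>
    have h1 : cj h v ≠ 0 := fun h0 => hv (cj_injective h (by simpa using h0))
    have h2 : cj g (cj h v) ≠ 0 := fun h0 => h1 (cj_injective g (by simpa using h0))
    rw [actX_mk (g * h) v hv (by rwa [cj_mul]), actX_mk h v hv h1, actX_mk g _ h1 h2]
    simp only [cj_mul]

theorem actX_actX_inv (g : U d) (x : CP d) : actX g (actX g⁻¹ x) = x := by
  rw [← actX_mul, mul_inv_cancel, actX_one]

theorem cj_mem_submodule (g : U d) (x : CP d) {v : E d} (hv : v ∈ x.submodule) :
    cj g v ∈ (actX g x).submodule := by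
  induction x using Projectivization.ind with
  | h w hw =>
    have h1 : cj g w ≠ 0 := fun h0 => hw (cj_injective g (by simpa using h0))
    rw [actX_mk g w hw h1, Projectivization.submodule_mk]
    rw [Projectivization.submodule_mk] at hv
    obtain ⟨c, rfl⟩ := Submodule.mem_span_singleton.1 hv
    exact Submodule.mem_span_singleton.2 ⟨c, by simp⟩

/-- The action of `g ∈ U(n)` on `L^m`, as a linear map `L^m_x → L^m_y` where `y = g.x`, given by
`(g.φ)(w) = φ(ḡ⁻¹ w)`. -/
def fibAct {m : ℤ} (g : U d) {x y : CP d} (h : actX g x = y) : Fib m x →ₗ[ℂ] Fib m y where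
  toFun φ := ⟨fun w => φ.1 (cj g⁻¹ w), by
    refine ⟨fun c hc v => ?_, fun w hw => ?_⟩
    · change φ.1 (cj g⁻¹ (c • v)) = c ^ m * φ.1 (cj g⁻¹ v)
      rw [map_smul, φ.2.1 c hc]
    · obtain ⟨h1, h2⟩ := φ.2.2 _ hw
      refine ⟨fun h0 => h1 (by simp [h0]), ?_⟩
      have := cj_mem_submodule g x h2
      rwa [cj_cj_inv, h] at this⟩
  map_add' _ _ := rfl
  map_smul' _ _ := rfl

/-- The action of `U(n)` on sections, `(g s)(x) = g.s(g⁻¹ x)`. -/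
def secAct {m : ℤ} (g : U d) : Sec d m →ₗ[ℂ] Sec d m where
  toFun s x := fibAct g (actX_actX_inv g x) (s (actX g⁻¹ x))
  map_add' _ _ := by funext x; simp
  map_smul' _ _ := by funext x; simp

theorem secAct_apply {m : ℤ} (g : U d) (s : Sec d m) (x : CP d) (v : E d) :
    (secAct g s x).1 v = (s (actX g⁻¹ x)).1 (cj g⁻¹ v) := rfl

theorem sec_congr {m : ℤ} (s : Sec d m) {x y : CP d} (h : x = y) (v : E d) :
    (s x).1 v = (s y).1 v := by
  subst h
  rfl

theorem lift_secAct {m : ℤ} (g : U d) (s : Sec d m) (v : E d) :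
    lift (secAct g s) v = lift s (cj g⁻¹ v) := by
  by_cases hv : v = 0
  · simp [lift, hv]
  · have h1 : cj g⁻¹ v ≠ 0 := fun h0 => hv (cj_injective g⁻¹ (by simpa using h0))
    rw [lift, lift, dif_pos hv, dif_pos h1, secAct_apply]
    exact sec_congr s (actX_mk _ _ _ _) _

theorem secAct_mem {m : ℤ} (g : U d) (s : Sec d m) (hs : s ∈ H0 d m) : secAct g s ∈ H0 d m := by
  change DifferentiableOn ℂ (lift (secAct g s)) {0}ᶜ
  have hs' : DifferentiableOn ℂ (lift s) {0}ᶜ := hs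
  rw [show lift (secAct g s) = lift s ∘ cj g⁻¹ from funext (lift_secAct g s)]
  refine hs'.comp (LinearMap.toContinuousLinearMap (cj g⁻¹)).differentiable.differentiableOn ?_
  intro v hv h0
  exact hv (cj_injective g⁻¹ (by simpa using h0))

/-- The representation `V(mλ) = H⁰(X, L^m)` of `U(n)`. -/
def V (d : ℕ) (m : ℤ) : Representation ℂ (U d) (H0 d m) where
  toFun g := (secAct g).restrict (secAct_mem g)
  map_one' := by
    ext s x v
    change (s.1 (actX 1⁻¹ x)).1 (cj 1⁻¹ v) = (s.1 x).1 v
    rw [inv_one, cj_one]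
    exact sec_congr s.1 (actX_one x) v
  map_mul' g h := by
    ext s x v
    change (s.1 (actX (g * h)⁻¹ x)).1 (cj (g * h)⁻¹ v) =
      (s.1 (actX h⁻¹ (actX g⁻¹ x))).1 (cj h⁻¹ (cj g⁻¹ v))
    rw [mul_inv_rev, cj_mul]
    exact sec_congr s.1 (actX_mul _ _ x) _

/-! ### The torus `T₀`, weights and the moment map -/

/-- The exponential map `𝔱₀ = ℝ^{n-1} → T₀`, onto the torus of diagonal unitary matrices with
upper-left coefficient `1`: `e^ξ = diag(1, e^{2πi ξ₂}, …, e^{2πi ξ_n})`. -/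
def expT (ξ : Fin d → ℝ) : U d :=
  ⟨Matrix.diagonal fun j =>
    Complex.exp (2 * Real.pi * Complex.I * ((Fin.cons 0 ξ : Fin (d + 1) → ℝ) j : ℝ)), by
    rw [Matrix.mem_unitaryGroup_iff, Matrix.star_eq_conjTranspose, Matrix.diagonal_conjTranspose,
      Matrix.diagonal_mul_diagonal, ← Matrix.diagonal_one]
    congr 1
    funext j
    rw [Pi.star_apply, Complex.star_def, ← Complex.exp_conj, ← Complex.exp_add]
    simp [Complex.conj_ofNat]⟩

/-- The weight space of weight `ν ∈ ℝ^{n-1} = 𝔱₀^*` in a representation of `U(n)`. -/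
def weightSpace {W : Type*} [AddCommMonoid W] [Module ℂ W] (ρ : Representation ℂ (U d) W)
    (ν : Fin d → ℝ) : Submodule ℂ W where
  carrier := {u | ∀ ξ : Fin d → ℝ,
    ρ (expT ξ) u = Complex.exp (2 * Real.pi * Complex.I * ((∑ j, ν j * ξ j : ℝ) : ℂ)) • u}
  zero_mem' := by simp
  add_mem' := by
    intro a b ha hb ξ
    rw [map_add, ha ξ, hb ξ, smul_add]
  smul_mem' := by
    intro c a ha ξ
    rw [map_smul, ha ξ, smul_comm]

/-- The set of (integral) weights of `T₀` on a representation of `U(n)`. -/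
def weights {W : Type*} [AddCommMonoid W] [Module ℂ W] (ρ : Representation ℂ (U d) W) :
    Set (Fin d → ℝ) :=
  {ν | (∀ j, ∃ a : ℤ, ν j = a) ∧ weightSpace ρ ν ≠ ⊥}

/-- The moment map `μ₀([z]) = (|z₂|², …, |z_n|²)/|z|²` of the action of `T₀`. -/
def moment (x : CP d) : Fin d → ℝ := fun j => ‖x.rep j.succ‖ ^ 2 / ‖x.rep‖ ^ 2

/-- The fibre `Λ_ν` of the moment map. -/
def Lam (ν : Fin d → ℝ) : Set (CP d) := {x | moment x = ν}

/-- The dimension of `Λ_ν`, for `ν` in the simplex `Δ`: this fibre is a torus, of the dimension of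
the face of `Δ` containing `ν` in its interior, which is one less than the number of nonzero
barycentric coordinates of `ν`. -/
def dimLam (ν : Fin d → ℝ) : ℕ :=
  open Classical in
  (Finset.univ.filter fun j => (Fin.cons (1 - ∑ i, ν i) ν : Fin (d + 1) → ℝ) j ≠ 0).card - 1

/-- The Riemannian volume of `Λ_ν` for the metric induced from `X`. -/
def volLam (ν : Fin d → ℝ) : Measure (Lam ν) := μHE[dimLam ν]

/-- Invariance under `T₀` of a section over a subset `Y`: `g.f(y) = f(g.y)` for all `g ∈ T₀`. -/
def IsInvariantOn {m : ℤ} {Y : Set (CP d)} (f : SecOn m Y) : Prop :=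
  ∀ (ξ : Fin d → ℝ) (y y' : Y) (h : actX (expT ξ) y = y'), fibAct (expT ξ) h (f y) = f y'

/-- The isotropic state `s_Λ(x) = ∫_Λ P(x, y).(ζ f)(y) dv_Λ(y)` for `Λ = Λ_ν`, where `ζ` and `f` are
sections of `L^a` and `L^b` over `Λ`, and `P` is the Bergman kernel of `L^{a+b}`. -/
def isoState {a b : ℤ} {ν : Fin d → ℝ} (ζ : SecOn a (Lam ν)) (f : SecOn b (Lam ν)) :
    Sec d (a + b) :=
  fun x => fibIntegral (volLam ν) fun y => bergman d (a + b) x y (tensor (ζ y) (f y))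

end CPQuant

end

/-!
The statement is soft once the Bergman kernel is known to be `∑ e_i(x) ⊗ e_i(y)^*` for a finite
family `e_i` of holomorphic sections, because integrating this kernel against a section `τ` over any
measured set gives the holomorphic section `s` characterized by the reproducing property
`⟨s, t⟩ = ∫ h(τ, t)` for all `t ∈ H⁰(X, L^m)` (`innerL2_frame`). Since the Bergman kernel is defined
as an unspecified kernel with the projection property, this requires existence
(`frameKer_isBergmanKernel`) and uniqueness (`eq_of_isBergmanKernel`) of such a kernel. They rest
on:

* the finite-dimensionality of `H⁰(X, L^m)` and the smoothness of its elements; by Liouville's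
  theorem, a holomorphic section is in each coordinate of an affine chart a polynomial of degree at
  most `m`, and so it is given by its values on a finite grid, through Lagrange interpolation;
* the finiteness of `dv_X` and its positivity on open sets, so that the `L²` product is an inner
  product. Hausdorff measures are compared with Lebesgue measures through Lipschitz maps.

The weight of `s_Λ` comes from that of `ζf`: along the orbits of one-parameter subgroups of `T₀`,
flatness of `ζ` is the equation `F' = cF` with `c = 2πi⟨pν, ξ⟩` (`liftOn_expT_of_flat`), so that `ζ`
has weight `pν`, while `f` has weight zero. As `T₀` acts on `X` and on `Λ_ν` by isometries, both
sides of the reproducing property are compatible with it, and `s_Λ` has weight `pν` as well.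

For the nonvanishing, `s_Λ` is paired with a nonzero vector `u` of weight `pν` in `H⁰(X, L^m)`. The
fibre `Λ_ν` is a single orbit of `T₀` of positive finite volume, on which `h(ζf, u)` is constant, so
it suffices that `u` does not vanish on `Λ_ν` (`lift_ne_zero_of_weight`). By analytic continuation
the homogeneous function of `u` transforms by a character of the complex torus, that is, it is a
multiple of a Laurent monomial, and the coordinates vanishing on `Λ_ν` have exponents `≤ 0` in it.
-/

noncomputable section

namespace CPQuant

/-! ### Entire functions of polynomial growth -/

/-- A form of Liouville's theorem, by induction on the degree: `(h(t) - h(0)) / t` is entire and of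
growth one less. -/
theorem exists_polynomial_of_growth (N : ℕ) : ∀ (h : ℂ → ℂ), Differentiable ℂ h →
    (∃ C : ℝ, ∀ t, ‖h t‖ ≤ C * (1 + ‖t‖) ^ N) →
    ∃ P : Polynomial ℂ, P.degree < (N + 1 : ℕ) ∧ ∀ t, h t = P.eval t := by
  induction N with
  | zero =>
    rintro h hd ⟨C, hC⟩
    obtain ⟨c, hc⟩ := hd.exists_const_forall_eq_of_bounded
      (isBounded_iff_forall_norm_le.2 ⟨C, by rintro _ ⟨t, rfl⟩; simpa using hC t⟩)
    refine ⟨Polynomial.C c, ?_, fun t => by simp [hc t]⟩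
    exact Polynomial.degree_C_le.trans_lt (by norm_num)
  | succ N ih =>
    rintro h hd ⟨C, hC⟩
    have hd' : Differentiable ℂ (dslope h 0) := fun t =>
      ((Complex.differentiableOn_dslope (s := Set.univ) (c := (0 : ℂ)) Filter.univ_mem).2
        hd.differentiableOn).differentiableAt Filter.univ_mem
    have hslope : ∀ t, h t = h 0 + t * dslope h 0 t := fun t => by
      have := sub_smul_dslope h 0 t
      rw [sub_zero, smul_eq_mul] at this
      rw [this]; ring
    obtain ⟨B, hB⟩ := (isCompact_closedBall (0 : ℂ) 1).exists_bound_of_continuousOn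
      hd'.continuous.continuousOn
    have hC0 : 0 ≤ C := by
      have := (norm_nonneg _).trans (hC 0)
      simpa using this
    obtain ⟨Q, hQ, hQe⟩ := ih _ hd' ⟨max B (4 * C), fun t => by
      rcases le_total ‖t‖ 1 with ht | ht
      · refine (hB t (by simpa using ht)).trans ?_
        have h1 : (1 : ℝ) ≤ (1 + ‖t‖) ^ N := one_le_pow₀ (by linarith [norm_nonneg t])
        have h2 : 0 ≤ max B (4 * C) := le_max_of_le_right (by linarith)
        nlinarith [le_max_left B (4 * C)]
      · have ht0 : (0 : ℝ) < ‖t‖ := by linarith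
        have h1 : ‖t‖ * ‖dslope h 0 t‖ ≤ 2 * C * (1 + ‖t‖) ^ (N + 1) := by
          have e : t * dslope h 0 t = h t - h 0 := by rw [hslope t]; ring
          rw [← norm_mul, e]
          refine (norm_sub_le _ _).trans ?_
          have h2 : ‖h 0‖ ≤ C * (1 + ‖t‖) ^ (N + 1) := by
            refine (hC 0).trans (mul_le_mul_of_nonneg_left ?_ hC0)
            simpa using one_le_pow₀ (M₀ := ℝ) (n := N + 1) (by linarith : 1 ≤ 1 + ‖t‖)
          linarith [hC t]
        have h3 : 2 * C * (1 + ‖t‖) ^ (N + 1) ≤ ‖t‖ * (4 * C * (1 + ‖t‖) ^ N) := by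
          have : (0 : ℝ) ≤ C * (1 + ‖t‖) ^ N := by positivity
          rw [pow_succ]
          nlinarith
        refine (le_of_mul_le_mul_left (h1.trans h3) ht0).trans ?_
        exact mul_le_mul_of_nonneg_right (le_max_right _ _) (by positivity)⟩
    refine ⟨Polynomial.C (h 0) + Polynomial.X * Q, ?_, fun t => by simp [hslope t, hQe]⟩
    refine (Polynomial.degree_add_le _ _).trans_lt (max_lt ?_ ?_)
    · exact Polynomial.degree_C_le.trans_lt (by exact_mod_cast Nat.succ_pos _)
    · rw [Polynomial.degree_mul, Polynomial.degree_X]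
      rw [Polynomial.degree_lt_iff_coeff_zero] at hQ
      have hQ' : Q.degree ≤ N := by
        rw [Polynomial.degree_le_iff_coeff_zero]
        intro k hk
        exact hQ k (by exact_mod_cast hk)
      calc (1 : WithBot ℕ) + Q.degree ≤ 1 + N := by gcongr
        _ < (N + 1 + 1 : ℕ) := by
          rw [add_comm]; exact_mod_cast Nat.lt_succ_self _

/-- The Lagrange basis polynomials for the nodes `0, …, N`. -/
def lag (N : ℕ) (k : Fin (N + 1)) : Polynomial ℂ :=
  Lagrange.basis Finset.univ (fun i : Fin (N + 1) => ((i : ℕ) : ℂ)) k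

/-- Lagrange interpolation of an entire function of growth at most `N`. -/
theorem eq_sum_lag {N : ℕ} {h : ℂ → ℂ} (hd : Differentiable ℂ h)
    (hg : ∃ C : ℝ, ∀ t, ‖h t‖ ≤ C * (1 + ‖t‖) ^ N) (t : ℂ) :
    h t = ∑ k : Fin (N + 1), h ((k : ℕ) : ℂ) * (lag N k).eval t := by
  obtain ⟨P, hP, hPe⟩ := exists_polynomial_of_growth N h hd hg
  have hinj : Set.InjOn (fun i : Fin (N + 1) => ((i : ℕ) : ℂ))
      (Finset.univ : Finset (Fin (N + 1))) := by
    intro i _ j _ hij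
    have hij' : ((i : ℕ) : ℂ) = ((j : ℕ) : ℂ) := hij
    exact Fin.ext (by exact_mod_cast hij')
  have key := Lagrange.eq_interpolate hinj (f := P) (by simpa using hP)
  rw [hPe t]
  conv_lhs => rw [key]
  simp [Lagrange.interpolate_apply, Polynomial.eval_finsetSum, lag, hPe]

section

variable {ι : Type*} [DecidableEq ι]

/-- `G` is, in each variable separately, an entire function of growth at most `N`. -/
def SepGrowth (N : ℕ) (G : (ι → ℂ) → ℂ) : Prop :=
  ∀ z i, Differentiable ℂ (fun t => G (Function.update z i t)) ∧
    ∃ C : ℝ, ∀ t, ‖G (Function.update z i t)‖ ≤ C * (1 + ‖t‖) ^ N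

/-- Lagrange interpolation in one of the variables; inserting the variables of a finite set one by
one expresses `G` through its values on the grid `{0, …, N}^ι`. -/
theorem SepGrowth.piecewise_insert {N : ℕ} {G : (ι → ℂ) → ℂ} (hG : SepGrowth N G) {S : Finset ι}
    {i : ι} (hi : i ∉ S) (z c : ι → ℂ) :
    G ((insert i S).piecewise z c) = ∑ k : Fin (N + 1),
      G (S.piecewise z (Function.update c i ((k : ℕ) : ℂ))) * (lag N k).eval (z i) := by
  have h := eq_sum_lag (hG (S.piecewise z c) i).1 (hG (S.piecewise z c) i).2 (z i)
  rw [Finset.piecewise_insert, h]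
  refine Finset.sum_congr rfl fun k _ => ?_
  congr 2
  rw [Finset.update_piecewise_of_notMem _ _ _ hi]

theorem SepGrowth.eq_zero [Fintype ι] {N : ℕ} {G : (ι → ℂ) → ℂ} (hG : SepGrowth N G)
    (h0 : ∀ a : ι → Fin (N + 1), G (fun i => ((a i : ℕ) : ℂ)) = 0) (z : ι → ℂ) : G z = 0 := by
  suffices H : ∀ S : Finset ι, ∀ a : ι → Fin (N + 1),
      G (S.piecewise z fun i => ((a i : ℕ) : ℂ)) = 0 by
    simpa using H Finset.univ 0
  intro S
  induction S using Finset.induction_on with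
  | empty => simpa using h0
  | insert i S hi ih =>
    intro a
    rw [hG.piecewise_insert hi]
    refine Finset.sum_eq_zero fun k _ => ?_
    have := ih (Function.update a i k)
    rw [show (fun j => ((Function.update a i k j : ℕ) : ℂ))
      = Function.update (fun j => ((a j : ℕ) : ℂ)) i ((k : ℕ) : ℂ) from ?_] at this
    · rw [this, zero_mul]
    · funext j
      by_cases hj : j = i
      · subst hj; simp
      · simp [hj]

theorem SepGrowth.contDiff [Fintype ι] {N : ℕ} {G : (ι → ℂ) → ℂ} (hG : SepGrowth N G) :
    ContDiff ℂ ∞ G := by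
  suffices H : ∀ S : Finset ι, ∀ c : ι → ℂ, ContDiff ℂ ∞ fun z => G (S.piecewise z c) by
    simpa using H Finset.univ 0
  intro S
  induction S using Finset.induction_on with
  | empty => intro c; simpa using contDiff_const
  | insert i S hi ih =>
    intro c
    simp_rw [hG.piecewise_insert hi]
    refine ContDiff.sum fun k _ => (ih _).mul ?_
    have : ContDiff ℂ ∞ fun t : ℂ => (lag N k).eval t := by
      simpa using (lag N k).contDiff_aeval (𝕜 := ℂ) ∞
    exact this.comp (contDiff_apply ℂ ℂ i)

end

variable {d : ℕ}

/-! ### Homogeneous functions and points of projective space -/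

/-- The line through a nonzero vector. -/
def pt (v : {v : E d // v ≠ 0}) : CP d := Projectivization.mk ℂ v.1 v.2

theorem exists_smul_of_mk_eq {v w : E d} (hv : v ≠ 0) (hw : w ≠ 0)
    (h : Projectivization.mk ℂ v hv = Projectivization.mk ℂ w hw) : ∃ c : ℂ, c ≠ 0 ∧ v = c • w := by
  obtain ⟨c, hc⟩ := (Projectivization.mk_eq_mk_iff' ℂ v w hv hw).1 h
  refine ⟨c, ?_, hc.symm⟩
  rintro rfl
  exact hv (by rw [← hc, zero_smul])

theorem mk_smul {v : E d} (hv : v ≠ 0) {c : ℂ} (hc : c ≠ 0) :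
    Projectivization.mk ℂ (c • v) (smul_ne_zero hc hv) = Projectivization.mk ℂ v hv :=
  (Projectivization.mk_eq_mk_iff' ℂ _ _ _ _).2 ⟨c, rfl⟩

theorem mk_congr {v w : E d} (h : v = w) (hv : v ≠ 0) (hw : w ≠ 0) :
    Projectivization.mk ℂ v hv = Projectivization.mk ℂ w hw := by subst h; rfl

theorem exists_unit_rep (x : CP d) : ∃ (v : E d) (hv : v ≠ 0),
    ‖v‖ = 1 ∧ Projectivization.mk ℂ v hv = x := by
  induction x using Projectivization.ind with
  | h w hw =>
    have hc : ((‖w‖⁻¹ : ℝ) : ℂ) ≠ 0 := by exact_mod_cast inv_ne_zero (norm_ne_zero_iff.2 hw)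
    refine ⟨((‖w‖⁻¹ : ℝ) : ℂ) • w, smul_ne_zero hc hw, ?_, mk_smul hw hc⟩
    rw [norm_smul, Complex.norm_real, norm_inv, norm_norm, inv_mul_cancel₀ (norm_ne_zero_iff.2 hw)]

theorem mem_submodule_mk {v : E d} (hv : v ≠ 0) {w : E d} :
    w ∈ (Projectivization.mk ℂ v hv).submodule ↔ ∃ c : ℂ, c • v = w := by
  rw [Projectivization.submodule_mk, Submodule.mem_span_singleton]

/-- An element of the fibre of `L^m` is determined by its value at one nonzero vector. -/
theorem Fib.ext_mk {m : ℤ} {v : E d} (hv : v ≠ 0) {φ ψ : Fib m (Projectivization.mk ℂ v hv)}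
    (h : φ.1 v = ψ.1 v) : φ = ψ := by
  ext w
  by_cases hw : w ≠ 0 ∧ w ∈ (Projectivization.mk ℂ v hv).submodule
  · obtain ⟨c, rfl⟩ := (mem_submodule_mk hv).1 hw.2
    have hc : c ≠ 0 := by rintro rfl; exact hw.1 (zero_smul _ _)
    rw [φ.2.1 c hc, ψ.2.1 c hc, h]
  · rw [not_imp_comm.1 (φ.2.2 w) hw, not_imp_comm.1 (ψ.2.2 w) hw]

theorem lift_of_ne {m : ℤ} (s : Sec d m) {v : E d} (hv : v ≠ 0) :
    lift s v = (s (Projectivization.mk ℂ v hv)).1 v := dif_pos hv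

theorem lift_smul {m : ℤ} (s : Sec d m) {c : ℂ} (hc : c ≠ 0) (v : E d) :
    lift s (c • v) = c ^ m * lift s v := by
  by_cases hv : v = 0
  · simp [lift, hv]
  · rw [lift_of_ne s hv, lift_of_ne s (smul_ne_zero hc hv), ← (s _).2.1 c hc]
    exact sec_congr s (mk_smul hv hc) _

theorem sec_ext {m : ℤ} {s t : Sec d m} (h : ∀ v, v ≠ 0 → lift s v = lift t v) : s = t := by
  funext x
  induction x using Projectivization.ind with
  | h v hv =>
    refine Fib.ext_mk hv ?_
    rw [← lift_of_ne, ← lift_of_ne]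
    exact h v hv

@[simp] theorem lift_add {m : ℤ} (s t : Sec d m) (v : E d) :
    lift (s + t) v = lift s v + lift t v := by
  by_cases hv : v = 0 <;> simp [lift, hv]

@[simp] theorem lift_const_smul {m : ℤ} (a : ℂ) (s : Sec d m) (v : E d) :
    lift (a • s) v = a * lift s v := by
  by_cases hv : v = 0 <;> simp [lift, hv]

@[simp] theorem lift_zero {m : ℤ} (v : E d) : lift (0 : Sec d m) v = 0 := by
  simp [lift]

/-- The section of `L^m` given by a homogeneous function of degree `m`. -/
def ofFun (m : ℤ) (F : E d → ℂ) (hF : ∀ c : ℂ, c ≠ 0 → ∀ v, v ≠ 0 → F (c • v) = c ^ m * F v) :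
    Sec d m := fun x =>
  ⟨fun v => open Classical in if v ≠ 0 ∧ v ∈ x.submodule then F v else 0, by
    refine ⟨fun c hc v => ?_, fun v hv => by by_contra h; simp [h] at hv⟩
    beta_reduce
    by_cases hv : v ≠ 0 ∧ v ∈ x.submodule
    · rw [if_pos hv, if_pos ⟨smul_ne_zero hc hv.1, Submodule.smul_mem _ _ hv.2⟩, hF c hc v hv.1]
    · rw [if_neg hv, if_neg, mul_zero]
      rintro ⟨h1, h2⟩
      exact hv ⟨fun h => h1 (by rw [h, smul_zero]), (Submodule.smul_mem_iff _ hc).1 h2⟩⟩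

theorem lift_ofFun {m : ℤ} {F : E d → ℂ}
    (hF : ∀ c : ℂ, c ≠ 0 → ∀ v, v ≠ 0 → F (c • v) = c ^ m * F v) {v : E d} (hv : v ≠ 0) :
    lift (ofFun m F hF) v = F v := by
  rw [lift_of_ne _ hv]
  exact if_pos ⟨hv, (mem_submodule_mk hv).2 ⟨1, one_smul _ _⟩⟩

/-- The Hermitian metric may be computed at any nonzero vector of the line. -/
theorem herm_eq {m : ℤ} {x : CP d} {v : E d} (hv : v ≠ 0) (hx : x = Projectivization.mk ℂ v hv)
    (φ ψ : Fib m x) :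
    herm φ ψ = φ.1 v * (starRingEnd ℂ) (ψ.1 v) / ((‖v‖ ^ (2 * m) : ℝ) : ℂ) := by
  obtain ⟨c, hc, hcv⟩ := exists_smul_of_mk_eq hv x.rep_nonzero (by rw [x.mk_rep, hx])
  have hcn : ‖c‖ ≠ 0 := norm_ne_zero_iff.2 hc
  have h1 : φ.1 v = c ^ m * φ.1 x.rep := by
    conv_lhs => rw [hcv]
    exact φ.2.1 c hc _
  have h2 : ψ.1 v = c ^ m * ψ.1 x.rep := by
    conv_lhs => rw [hcv]
    exact ψ.2.1 c hc _
  have h3 : ‖v‖ = ‖c‖ * ‖x.rep‖ := by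
    conv_lhs => rw [hcv]
    exact norm_smul _ _
  have h4 : (((‖c‖ ^ (2 * m) : ℝ)) : ℂ) = c ^ m * (starRingEnd ℂ) (c ^ m) := by
    rw [Complex.mul_conj, Complex.normSq_eq_norm_sq, norm_zpow, two_mul, zpow_add₀ hcn, sq]
  have h5 : (((‖c‖ ^ (2 * m) : ℝ)) : ℂ) ≠ 0 := by exact_mod_cast zpow_ne_zero _ hcn
  rw [herm, h1, h2, h3, mul_zpow, Complex.ofReal_mul, map_mul,
    mul_mul_mul_comm, ← h4, mul_div_mul_left _ _ h5]

theorem herm_lift {m : ℤ} (s t : Sec d m) {v : E d} (hv : v ≠ 0) :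
    herm (s (Projectivization.mk ℂ v hv)) (t (Projectivization.mk ℂ v hv)) =
      lift s v * (starRingEnd ℂ) (lift t v) / ((‖v‖ ^ (2 * m) : ℝ) : ℂ) := by
  rw [herm_eq hv rfl, lift_of_ne s hv, lift_of_ne t hv]

/-- The embedding `projEmb` may be computed at any nonzero vector of the line. -/
theorem projEmb_mk {v : E d} (hv : v ≠ 0) : projEmb (Projectivization.mk ℂ v hv) =
    WithLp.toLp 2 fun ij => ((1 / Real.sqrt (2 * Real.pi) : ℝ) : ℂ) *
      (v ij.1 * (starRingEnd ℂ) (v ij.2) / ((‖v‖ ^ 2 : ℝ) : ℂ)) := by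
  set x := Projectivization.mk ℂ v hv with hx
  obtain ⟨c, hc, hcv⟩ := exists_smul_of_mk_eq hv x.rep_nonzero (by rw [x.mk_rep])
  have hcn : ‖c‖ ≠ 0 := norm_ne_zero_iff.2 hc
  have h3 : ‖v‖ = ‖c‖ * ‖x.rep‖ := by
    conv_lhs => rw [hcv]
    exact norm_smul _ _
  have h4 : (((‖c‖ ^ 2 : ℝ)) : ℂ) = c * (starRingEnd ℂ) c := by
    rw [Complex.mul_conj, Complex.normSq_eq_norm_sq]
  have h5 : (((‖c‖ ^ 2 : ℝ)) : ℂ) ≠ 0 := by exact_mod_cast pow_ne_zero _ hcn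
  have h6 : ∀ i, v i = c * x.rep i := fun i => by
    conv_lhs => rw [hcv]
    rfl
  rw [projEmb]
  congr 1
  funext ij
  rw [h6, h6, h3, mul_pow, Complex.ofReal_mul, map_mul, mul_mul_mul_comm, ← h4,
    mul_div_mul_left _ _ h5]

theorem isometry_projEmb : Isometry (projEmb (d := d)) := fun _ _ => rfl

theorem continuous_mk : Continuous (pt (d := d)) := by
  rw [isometry_projEmb.isEmbedding.continuous_iff]
  have : (projEmb ∘ pt (d := d)) = fun v : {v : E d // v ≠ 0} => WithLp.toLp 2 fun ij =>
    ((1 / Real.sqrt (2 * Real.pi) : ℝ) : ℂ) *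
      (v.1 ij.1 * (starRingEnd ℂ) (v.1 ij.2) / ((‖v.1‖ ^ 2 : ℝ) : ℂ)) := by
    funext v
    exact projEmb_mk v.2
  rw [this]
  refine (PiLp.continuous_toLp 2 _).comp (continuous_pi fun ij => continuous_const.mul ?_)
  refine Continuous.div (by fun_prop) (by fun_prop) fun v => ?_
  have := norm_ne_zero_iff.2 v.2
  exact_mod_cast pow_ne_zero 2 this

theorem liftOn_of_mem {m : ℤ} {Y : Set (CP d)} (s : SecOn m Y) {v : E d} (hv : v ≠ 0)
    (hy : Projectivization.mk ℂ v hv ∈ Y) : liftOn s v = (s ⟨_, hy⟩).1 v :=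
  dif_pos (⟨hv, hy⟩ : ∃ hv : v ≠ 0, Projectivization.mk ℂ v hv ∈ Y)

theorem compact_sphere_cone {Y : Set (CP d)} (hY : IsClosed Y) :
    IsCompact {v : E d | ‖v‖ = 1 ∧ v ∈ cone Y} := by
  have hs : {v : E d | ‖v‖ = 1 ∧ v ∈ cone Y} =
      (fun v : Metric.sphere (0 : E d) 1 => v.1) ''
        ((fun v : Metric.sphere (0 : E d) 1 =>
          pt ⟨v.1, ne_zero_of_mem_unit_sphere v⟩) ⁻¹' Y) := by
    ext v
    constructor
    · rintro ⟨h1, h2, h3⟩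
      exact ⟨⟨v, by simpa using h1⟩, h3, rfl⟩
    · rintro ⟨w, hw, rfl⟩
      exact ⟨by simp, ne_zero_of_mem_unit_sphere w, hw⟩
  rw [hs]
  have hc : Continuous fun v : Metric.sphere (0 : E d) 1 =>
      pt ⟨v.1, ne_zero_of_mem_unit_sphere v⟩ :=
    continuous_mk.comp (by fun_prop)
  exact ((hY.preimage hc).isCompact).image continuous_subtype_val

/-- The projection of the unit vectors of the cone over a closed set `Y` to `Y` is a quotient map,
so functions on `Y` may be tested for continuity on the cone. -/
theorem continuous_of_cone {α : Type*} [TopologicalSpace α] {Y : Set (CP d)} (hY : IsClosed Y)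
    {g : Y → α} {h : E d → α}
    (hc : ContinuousOn h (cone Y))
    (hgh : ∀ v (hv : v ≠ 0) (hy : Projectivization.mk ℂ v hv ∈ Y), h v = g ⟨_, hy⟩) :
    Continuous g := by
  let S := {v : E d | ‖v‖ = 1 ∧ v ∈ cone Y}
  let q : S → Y := fun v => ⟨Projectivization.mk ℂ v.1 v.2.2.choose, v.2.2.choose_spec⟩
  have hq : Continuous q :=
    (continuous_mk.comp (by fun_prop :
      Continuous fun v : S => (⟨v.1, v.2.2.choose⟩ : {v : E d // v ≠ 0}))).subtype_mk _
  have : CompactSpace S := isCompact_iff_compactSpace.1 (compact_sphere_cone hY)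
  have hqs : Function.Surjective q := by
    rintro ⟨y, hy⟩
    obtain ⟨v, hv, h1, rfl⟩ := exists_unit_rep y
    exact ⟨⟨v, h1, hv, hy⟩, rfl⟩
  have hqm : Topology.IsQuotientMap q := hq.isClosedMap.isQuotientMap hq hqs
  rw [hqm.continuous_iff]
  have : g ∘ q = fun v : S => h v.1 := by
    funext v
    exact (hgh _ _ _).symm
  rw [this]
  exact (continuousOn_iff_continuous_domRestrict.1 (hc.mono fun v hv => hv.2))

theorem continuous_of_lift {α : Type*} [TopologicalSpace α] {g : CP d → α} {h : E d → α}
    (hc : ContinuousOn h {0}ᶜ) (hgh : ∀ v (hv : v ≠ 0), h v = g (Projectivization.mk ℂ v hv)) :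
    Continuous g := by
  have := continuous_of_cone (Y := Set.univ) isClosed_univ (g := fun y => g y.1) (h := h)
    (hc.mono fun v hv => hv.choose) fun v hv _ => hgh v hv
  have hi : Continuous fun x : CP d => (⟨x, trivial⟩ : (Set.univ : Set (CP d))) := by fun_prop
  exact this.comp hi

instance : CompactSpace (CP d) := by
  rw [← isCompact_univ_iff]
  have hc : Continuous fun v : Metric.sphere (0 : E d) 1 =>
      pt ⟨v.1, ne_zero_of_mem_unit_sphere v⟩ :=
    continuous_mk.comp (by fun_prop)
  convert isCompact_range hc
  symm
  rw [Set.eq_univ_iff_forall]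
  intro x
  obtain ⟨v, hv, h1, rfl⟩ := exists_unit_rep x
  exact ⟨⟨v, by simpa using h1⟩, rfl⟩

/-! ### Hausdorff measures of parametrized sets -/

theorem euclideanHausdorffMeasure_ne_top_iff {X : Type*} [EMetricSpace X] [MeasurableSpace X]
    [BorelSpace X] (k : ℕ) (s : Set X) :
    (μHE[k] : Measure X) s ≠ ⊤ ↔ (Measure.hausdorffMeasure (k : ℝ) : Measure X) s ≠ ⊤ := by
  rw [Measure.euclideanHausdorffMeasure_def, Measure.smul_apply, ENNReal.smul_def, smul_eq_mul]
  have h := Measure.addHaarScalarFactor_volume_hausdorffMeasure_ne_zero k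
  constructor
  · intro hs ht
    exact hs (by rw [ht, ENNReal.mul_top (by exact_mod_cast h)])
  · exact fun hs => ENNReal.mul_ne_top ENNReal.coe_ne_top hs

theorem euclideanHausdorffMeasure_ne_zero_iff {X : Type*} [EMetricSpace X] [MeasurableSpace X]
    [BorelSpace X] (k : ℕ) (s : Set X) :
    (μHE[k] : Measure X) s ≠ 0 ↔ (Measure.hausdorffMeasure (k : ℝ) : Measure X) s ≠ 0 := by
  rw [Measure.euclideanHausdorffMeasure_def, Measure.smul_apply, ENNReal.smul_def, smul_eq_mul]
  have h := Measure.addHaarScalarFactor_volume_hausdorffMeasure_ne_zero k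
  simp [h]

section
variable {V W : Type*} [NormedAddCommGroup V] [NormedSpace ℝ V] [FiniteDimensional ℝ V]
  [MeasurableSpace V] [BorelSpace V] [NormedAddCommGroup W] [NormedSpace ℝ W]
  {X : Type*} [MetricSpace X] [MeasurableSpace X] [BorelSpace X] {e : X → W}

/-- The image of a compact set under a `C¹` map from a `k`-dimensional space has finite
`k`-dimensional measure. -/
theorem euclideanHausdorffMeasure_image_ne_top {k : ℕ} (hk : Module.finrank ℝ V = k)
    (he : Isometry e) {φ : V → X} (hφ : ContDiff ℝ 1 (e ∘ φ)) {K : Set V} (hK : IsCompact K) :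
    (μHE[k] : Measure X) (φ '' K) ≠ ⊤ := by
  rw [euclideanHausdorffMeasure_ne_top_iff]
  obtain ⟨C, hC⟩ :=
    (hφ.locallyLipschitz.locallyLipschitzOn (s := K)).exists_lipschitzOnWith_of_compact hK
  have hC' : LipschitzOnWith C φ K := fun x hx y hy => by
    have := hC hx hy
    rwa [Function.comp_apply, Function.comp_apply, he.edist_eq] at this
  refine ne_top_of_le_ne_top (ENNReal.mul_ne_top ?_ ?_)
    (hC'.hausdorffMeasure_image_le (d := (k : ℝ)) (Nat.cast_nonneg k))
  · exact ENNReal.rpow_ne_top_of_nonneg (Nat.cast_nonneg k) ENNReal.coe_ne_top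
  · subst hk
    exact hK.measure_ne_top

/-- A set with a Lipschitz map to a `k`-dimensional space whose image has interior points has
nonzero `k`-dimensional measure. -/
theorem euclideanHausdorffMeasure_ne_zero {k : ℕ} (hk : Module.finrank ℝ V = k)
    {T : Set X} {ψ : X → V} {C : NNReal} (hψ : LipschitzOnWith C ψ T)
    (h : (interior (ψ '' T)).Nonempty) :
    (μHE[k] : Measure X) T ≠ 0 := by
  rw [euclideanHausdorffMeasure_ne_zero_iff]
  intro h0
  have h1 := hψ.hausdorffMeasure_image_le (d := (k : ℝ)) (Nat.cast_nonneg k)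
  rw [h0, mul_zero, nonpos_iff_eq_zero] at h1
  subst hk
  exact (isOpen_interior.measure_pos _ h).ne' (measure_mono_null interior_subset h1)

end

/-! ### The Riemannian volume of projective space -/

/-- The vector with coordinate `1` at the place `j` and the other coordinates given by `z`. -/
def chartVec (j : Fin (d + 1)) (z : Fin d → ℂ) : E d :=
  WithLp.toLp 2 (Fin.insertNth (α := fun _ => ℂ) j 1 z)

@[simp] theorem chartVec_same (j : Fin (d + 1)) (z : Fin d → ℂ) : chartVec j z j = 1 := by
  simp [chartVec]

@[simp] theorem chartVec_succAbove (j : Fin (d + 1)) (z : Fin d → ℂ) (i : Fin d) :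
    chartVec j z (j.succAbove i) = z i := by
  simp [chartVec]

theorem chartVec_ne (j : Fin (d + 1)) (z : Fin d → ℂ) : chartVec j z ≠ 0 := fun h => by
  have := chartVec_same j z
  rw [h] at this
  simp at this

theorem contDiff_chartVec {𝕜 : Type*} [NontriviallyNormedField 𝕜] [NormedAlgebra 𝕜 ℂ]
    {n : WithTop ℕ∞} (j : Fin (d + 1)) : ContDiff 𝕜 n (chartVec (d := d) j) := by
  rw [contDiff_piLp]
  intro i
  rcases Fin.eq_self_or_eq_succAbove j i with rfl | ⟨k, rfl⟩
  · simpa using contDiff_const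
  · simpa using contDiff_apply 𝕜 ℂ k

/-- The standard affine chart. -/
def chart (j : Fin (d + 1)) (z : Fin d → ℂ) : CP d := Projectivization.mk ℂ _ (chartVec_ne j z)

theorem eq_smul_chartVec {v : E d} {j : Fin (d + 1)} (hj : v j ≠ 0) :
    v = v j • chartVec j fun i => v (j.succAbove i) / v j := by
  ext i
  rcases Fin.eq_self_or_eq_succAbove j i with rfl | ⟨k, rfl⟩
  · simp
  · simp [mul_div_cancel₀ _ hj]

theorem contDiff_norm_sq_ofReal {n : WithTop ℕ∞} :
    ContDiff ℝ n fun v : E d => ((‖v‖ ^ 2 : ℝ) : ℂ) :=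
  Complex.ofRealCLM.contDiff.comp (contDiff_norm_sq ℂ)

theorem contDiff_coord_mul_conj {n : WithTop ℕ∞} (i j : Fin (d + 1)) :
    ContDiff ℝ n fun v : E d => v i * (starRingEnd ℂ) (v j) := by
  have h : ∀ i, ContDiff ℝ n fun v : E d => v i := fun i => contDiff_piLp_apply (𝕜 := ℝ) 2
  exact (h i).mul (Complex.conjCLE.contDiff.comp (h j))

theorem contDiff_projEmb_comp {V : Type*} [NormedAddCommGroup V] [NormedSpace ℝ V] {n : WithTop ℕ∞}
    {u : V → E d} (hu : ContDiff ℝ n u) (hu0 : ∀ z, u z ≠ 0) :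
    ContDiff ℝ n (projEmb ∘ fun z => Projectivization.mk ℂ (u z) (hu0 z)) := by
  have : (projEmb ∘ fun z => Projectivization.mk ℂ (u z) (hu0 z)) = _ :=
    funext fun z => projEmb_mk (hu0 z)
  rw [this, contDiff_piLp]
  intro ij
  have h1 := (contDiff_coord_mul_conj (n := n) ij.1 ij.2).comp hu
  have h2 := (contDiff_norm_sq_ofReal (d := d) (n := n)).comp hu
  simp only [div_eq_mul_inv]
  refine contDiff_const.mul (h1.mul (h2.inv fun z => ?_))
  exact Complex.ofReal_ne_zero.2 (pow_ne_zero 2 (norm_ne_zero_iff.2 (hu0 z)))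

theorem exists_norm_max (v : E d) : ∃ j, ∀ i, ‖v i‖ ≤ ‖v j‖ := by
  obtain ⟨j, -, hj⟩ := Finset.exists_max_image Finset.univ (fun i => ‖v i‖) Finset.univ_nonempty
  exact ⟨j, fun i => hj i (Finset.mem_univ _)⟩

theorem coord_ne_of_max {v : E d} (hv : v ≠ 0) {j : Fin (d + 1)} (hj : ∀ i, ‖v i‖ ≤ ‖v j‖) :
    v j ≠ 0 := fun h => hv (by
  ext i
  have := hj i
  rw [h, norm_zero] at this
  simpa using this)

theorem mk_eq_chart {v : E d} (hv : v ≠ 0) {j : Fin (d + 1)} (hj : v j ≠ 0) :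
    Projectivization.mk ℂ v hv = chart j fun i => v (j.succAbove i) / v j := by
  rw [chart, ← mk_smul (chartVec_ne _ _) hj]
  exact mk_congr (eq_smul_chartVec hj) _ _

theorem finrank_chart : Module.finrank ℝ (Fin d → ℂ) = 2 * d := by
  rw [Module.finrank_pi_fintype]
  simp [mul_comm]

/-- Projective space is covered by the images of the closed unit polydisc in the affine charts. -/
instance : IsFiniteMeasure (volX d) := by
  refine ⟨lt_of_le_of_lt (measure_mono (t := ⋃ j : Fin (d + 1),
    chart j '' Metric.closedBall 0 1) ?_) ?_⟩
  · intro x _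
    induction x using Projectivization.ind with
    | h v hv =>
      obtain ⟨j, hj⟩ := exists_norm_max v
      have hj0 := coord_ne_of_max hv hj
      refine Set.mem_iUnion.2 ⟨j, _, ?_, (mk_eq_chart hv hj0).symm⟩
      rw [mem_closedBall_zero_iff, pi_norm_le_iff_of_nonneg zero_le_one]
      intro i
      rw [norm_div]
      exact div_le_one_of_le₀ (hj _) (norm_nonneg _)
  · refine (measure_iUnion_fintype_le _ _).trans_lt (ENNReal.sum_lt_top.2 fun j _ => ?_)
    exact (euclideanHausdorffMeasure_image_ne_top finrank_chart isometry_projEmb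
      (contDiff_projEmb_comp (contDiff_chartVec j) (chartVec_ne j))
      (isCompact_closedBall 0 1)).lt_top

/-- An affine chart has a left inverse that is a rational function of the embedding `projEmb`, hence
locally Lipschitz. -/
instance : (volX d).IsOpenPosMeasure := by
  refine ⟨fun O hO hne => ?_⟩
  obtain ⟨x, hx⟩ := hne
  induction x using Projectivization.ind with
  | h v hv =>
    obtain ⟨j, hj⟩ := exists_norm_max v
    have hj0 := coord_ne_of_max hv hj
    rw [mk_eq_chart hv hj0] at hx
    set z := fun i => v (j.succAbove i) / v j
    -- The affine coordinates `z_i / z_j`, in terms of the entries `z_i z̄_j` of the projection.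
    let ψ : EuclideanSpace ℂ (Fin (d + 1) × Fin (d + 1)) → (Fin d → ℂ) :=
      fun M i => M (j.succAbove i, j) / M (j, j)
    have hval : ∀ u : Fin d → ℂ, ∀ i, projEmb (chart j u) (i, j) =
        ((1 / Real.sqrt (2 * Real.pi) : ℝ) : ℂ) *
          (chartVec j u i / ((‖chartVec j u‖ ^ 2 : ℝ) : ℂ)) := by
      intro u i
      rw [chart, projEmb_mk (chartVec_ne j u)]
      simp
    have hc0 : ((1 / Real.sqrt (2 * Real.pi) : ℝ) : ℂ) ≠ 0 := by
      have : (0 : ℝ) < 1 / Real.sqrt (2 * Real.pi) := by positivity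
      exact_mod_cast this.ne'
    have hn0 : ∀ u : Fin d → ℂ, ((‖chartVec j u‖ ^ 2 : ℝ) : ℂ) ≠ 0 := fun u => by
      exact_mod_cast pow_ne_zero 2 (norm_ne_zero_iff.2 (chartVec_ne j u))
    have hψ : ∀ u, ψ (projEmb (chart j u)) = u := by
      intro u
      funext i
      have h1 := hn0 u
      simp only [ψ, hval, chartVec_succAbove, chartVec_same]
      rw [mul_div_mul_left _ _ hc0, div_div_div_cancel_right₀ h1, div_one]
    have hψd : ContDiffAt ℝ 1 ψ (projEmb (chart j z)) := by
      refine contDiffAt_pi.2 fun i => ?_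
      have h (ij : Fin (d + 1) × Fin (d + 1)) : ContDiffAt ℝ 1
          (fun M : EuclideanSpace ℂ (Fin (d + 1) × Fin (d + 1)) => M ij) (projEmb (chart j z)) :=
        (contDiff_piLp_apply (𝕜 := ℝ) 2).contDiffAt
      simp only [ψ, div_eq_mul_inv]
      refine (h (j.succAbove i, j)).mul ((h (j, j)).inv ?_)
      rw [hval, chartVec_same]
      exact mul_ne_zero hc0 (div_ne_zero one_ne_zero (hn0 z))
    obtain ⟨C, t, ht, hC⟩ := hψd.exists_lipschitzOnWith
    have hcont : Continuous (chart (d := d) j) := by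
      rw [isometry_projEmb.isEmbedding.continuous_iff]
      exact (contDiff_projEmb_comp (n := 1) (contDiff_chartVec j) (chartVec_ne j)).continuous
    have hT : projEmb ⁻¹' t ∩ O ∈ nhds (chart j z) :=
      Filter.inter_mem (isometry_projEmb.continuous.continuousAt.preimage_mem_nhds ht)
        (hO.mem_nhds hx)
    have hL : LipschitzOnWith C (ψ ∘ projEmb) (projEmb ⁻¹' t ∩ O) := fun a ha b hb => by
      have := hC ha.1 hb.1
      rwa [isometry_projEmb.edist_eq] at this
    refine fun h0 => euclideanHausdorffMeasure_ne_zero finrank_chart hL ?_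
      (measure_mono_null Set.inter_subset_right h0)
    refine ⟨z, mem_interior_iff_mem_nhds.2 ?_⟩
    filter_upwards [hcont.continuousAt.preimage_mem_nhds hT] with u hu
    exact ⟨_, hu, hψ u⟩

/-! ### The fibres of the moment map -/

/-- The vector `(z_j e^{iθ_j})_j`. -/
def rot (θ : Fin (d + 1) → ℝ) (z : E d) : E d :=
  WithLp.toLp 2 fun j => z j * Complex.exp ((θ j : ℂ) * Complex.I)

@[simp] theorem rot_apply (θ : Fin (d + 1) → ℝ) (z : E d) (j : Fin (d + 1)) :
    rot θ z j = z j * Complex.exp ((θ j : ℂ) * Complex.I) := rfl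

theorem norm_rot_apply (θ : Fin (d + 1) → ℝ) (z : E d) (j : Fin (d + 1)) :
    ‖rot θ z j‖ = ‖z j‖ := by
  rw [rot_apply, norm_mul, Complex.norm_exp_ofReal_mul_I, mul_one]

theorem norm_eq_of_coord {v w : E d} (h : ∀ j, ‖v j‖ = ‖w j‖) : ‖v‖ = ‖w‖ := by
  simp [EuclideanSpace.norm_eq, h]

theorem norm_rot (θ : Fin (d + 1) → ℝ) (z : E d) : ‖rot θ z‖ = ‖z‖ :=
  norm_eq_of_coord (norm_rot_apply θ z)

theorem rot_ne {θ : Fin (d + 1) → ℝ} {z : E d} (hz : z ≠ 0) : rot θ z ≠ 0 := by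
  rw [← norm_ne_zero_iff, norm_rot]
  exact norm_ne_zero_iff.2 hz

theorem contDiff_rot {n : WithTop ℕ∞} (z : E d) : ContDiff ℝ n fun θ => rot θ z := by
  rw [contDiff_piLp]
  intro i
  refine contDiff_const.mul (Complex.contDiff_exp.comp ?_)
  exact (Complex.ofRealCLM.contDiff.comp (contDiff_apply ℝ ℝ i)).mul contDiff_const

theorem moment_mk {v : E d} (hv : v ≠ 0) (j : Fin d) :
    moment (Projectivization.mk ℂ v hv) j = ‖v j.succ‖ ^ 2 / ‖v‖ ^ 2 := by
  set x := Projectivization.mk ℂ v hv with hx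
  obtain ⟨c, hc, hcv⟩ := exists_smul_of_mk_eq hv x.rep_nonzero (by rw [x.mk_rep])
  have hcn : ‖c‖ ^ 2 ≠ 0 := pow_ne_zero 2 (norm_ne_zero_iff.2 hc)
  have h3 : ‖v‖ = ‖c‖ * ‖x.rep‖ := by
    conv_lhs => rw [hcv]
    exact norm_smul _ _
  have h6 : v j.succ = c * x.rep j.succ := by
    conv_lhs => rw [hcv]
    rfl
  rw [h6, h3, norm_mul, mul_pow, mul_pow, mul_div_mul_left _ _ hcn]
  rfl

/-- The barycentric coordinates of a point of the simplex. -/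
def bary (ν : Fin d → ℝ) : Fin (d + 1) → ℝ := Fin.cons (1 - ∑ i, ν i) ν

theorem mk_mem_Lam {ν : Fin d → ℝ} {v : E d} (hv : v ≠ 0) :
    Projectivization.mk ℂ v hv ∈ Lam ν ↔ ∀ j, ‖v j‖ ^ 2 = bary ν j * ‖v‖ ^ 2 := by
  have hn : ‖v‖ ^ 2 ≠ 0 := pow_ne_zero 2 (norm_ne_zero_iff.2 hv)
  have hS : ‖v‖ ^ 2 = ‖v 0‖ ^ 2 + ∑ j : Fin d, ‖v j.succ‖ ^ 2 := by
    rw [EuclideanSpace.norm_sq_eq, Fin.sum_univ_succ]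
  constructor
  · intro h
    have h1 : ∀ j : Fin d, ‖v j.succ‖ ^ 2 = ν j * ‖v‖ ^ 2 := fun j => by
      have := congrFun (show moment _ = ν from h) j
      rw [moment_mk hv, div_eq_iff hn] at this
      exact this
    intro j
    refine Fin.cases ?_ (fun j => ?_) j
    · simp only [bary, Fin.cons_zero]
      simp_rw [h1] at hS
      rw [← Finset.sum_mul] at hS
      linarith
    · simpa [bary] using h1 j
  · intro h
    funext j
    rw [moment_mk hv, div_eq_iff hn, h]
    simp [bary]

theorem rot_mem_Lam {ν : Fin d → ℝ} {v : E d} (hv : v ∈ cone (Lam ν)) (θ : Fin (d + 1) → ℝ) :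
    rot θ v ∈ cone (Lam ν) := by
  obtain ⟨h0, h⟩ := hv
  refine ⟨rot_ne h0, ?_⟩
  rw [mk_mem_Lam] at h ⊢
  simpa [norm_rot, norm_rot_apply] using h

theorem isClosed_Lam (ν : Fin d → ℝ) : IsClosed (Lam ν) := by
  have : Continuous (moment (d := d)) := by
    refine continuous_pi fun j => ?_
    refine continuous_of_lift (h := fun v => ‖v j.succ‖ ^ 2 / ‖v‖ ^ 2) ?_
      fun v hv => (moment_mk hv j).symm
    refine ContinuousOn.div (by fun_prop) (by fun_prop) fun v hv => ?_
    exact pow_ne_zero 2 (norm_ne_zero_iff.2 hv)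
  exact isClosed_eq this continuous_const

/-- A fibre of the moment map is an orbit of the torus of diagonal unitary matrices; one of the
angles may be taken to be zero. -/
theorem exists_rot {ν : Fin d → ℝ} {z : E d} (hz : ‖z‖ = 1) (hzL : z ∈ cone (Lam ν))
    (j₀ : Fin (d + 1)) {y : CP d} (hy : y ∈ Lam ν) :
    ∃ θ : Fin (d + 1) → ℝ, θ j₀ = 0 ∧ (∀ j, ‖θ j‖ ≤ Real.pi) ∧ (∀ j, z j = 0 → θ j = 0) ∧
      ∃ h : rot θ z ≠ 0, Projectivization.mk ℂ (rot θ z) h = y := by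
  obtain ⟨w, hw, hw1, rfl⟩ := exists_unit_rep y
  obtain ⟨hz0, hzL⟩ := hzL
  rw [mk_mem_Lam] at hy hzL
  have hn : ∀ j, ‖w j‖ = ‖z j‖ := fun j => by
    refine (pow_left_inj₀ (norm_nonneg _) (norm_nonneg _) two_ne_zero).1 ?_
    rw [hy, hzL, hw1, hz]
  -- The representative of `y` is rotated so that its coordinate of index `j₀` agrees with `z j₀`.
  let c : ℂ := if z j₀ = 0 then 1 else z j₀ / w j₀
  have hwj : z j₀ ≠ 0 → w j₀ ≠ 0 := fun h => by
    rw [← norm_ne_zero_iff, hn]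
    exact norm_ne_zero_iff.2 h
  have hc1 : ‖c‖ = 1 := by
    by_cases h : z j₀ = 0
    · simp [c, h]
    · simp only [c, if_neg h, norm_div, hn]
      exact div_self (norm_ne_zero_iff.2 h)
  have hc0 : c ≠ 0 := norm_ne_zero_iff.1 (by rw [hc1]; exact one_ne_zero)
  let θ : Fin (d + 1) → ℝ := fun j => Complex.arg (c * w j / z j)
  have hθ : rot θ z = c • w := by
    ext j
    rw [rot_apply, PiLp.smul_apply, smul_eq_mul]
    by_cases h : z j = 0
    · have : w j = 0 := norm_eq_zero.1 (by rw [hn, h, norm_zero])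
      rw [h, this, zero_mul, mul_zero]
    · have h1 : ‖c * w j / z j‖ = 1 := by
        rw [norm_div, norm_mul, hc1, one_mul, hn, div_self (norm_ne_zero_iff.2 h)]
      have h2 := Complex.norm_mul_exp_arg_mul_I (c * w j / z j)
      rw [h1, Complex.ofReal_one, one_mul] at h2
      rw [h2, mul_div_cancel₀ _ h]
  refine ⟨θ, ?_, fun j => Complex.abs_arg_le_pi _, fun j hj => by simp [θ, hj], ?_⟩
  · by_cases h : z j₀ = 0
    · simp [θ, h]
    · simp only [θ, c, if_neg h, div_mul_cancel₀ _ (hwj h), div_self h, Complex.arg_one]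
  · refine ⟨rot_ne hz0, ?_⟩
    rw [← mk_smul hw hc0]
    exact mk_congr hθ _ _

theorem exists_unit_mem_cone {Y : Set (CP d)} (hY : Y.Nonempty) :
    ∃ z : E d, ‖z‖ = 1 ∧ z ∈ cone Y := by
  obtain ⟨y, hy⟩ := hY
  obtain ⟨z, hz0, hz1, rfl⟩ := exists_unit_rep y
  exact ⟨z, hz1, hz0, hy⟩

theorem bary_eq_zero_iff {ν : Fin d → ℝ} {z : E d} (hz : z ∈ cone (Lam ν)) (j : Fin (d + 1)) :
    bary ν j = 0 ↔ z j = 0 := by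
  obtain ⟨hz0, hzL⟩ := hz
  have hn : ‖z‖ ^ 2 ≠ 0 := pow_ne_zero 2 (norm_ne_zero_iff.2 hz0)
  have := (mk_mem_Lam hz0).1 hzL j
  constructor
  · intro h
    rw [h, zero_mul] at this
    simpa using this
  · intro h
    rw [h, norm_zero] at this
    simpa [hn] using this

/-- The angles `θ_j` for `j` in a subset, extended by zero. -/
def extAngle {P : Fin (d + 1) → Prop} (θ : {j // P j} → ℝ) (j : Fin (d + 1)) : ℝ :=
  open Classical in if h : P j then θ ⟨j, h⟩ else 0

theorem contDiff_extAngle {P : Fin (d + 1) → Prop} [Fintype {j // P j}] {n : WithTop ℕ∞} :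
    ContDiff ℝ n (extAngle (P := P)) := by
  rw [contDiff_pi]
  intro j
  by_cases h : P j
  · simpa [extAngle, h] using contDiff_apply ℝ ℝ (⟨j, h⟩ : {j // P j})
  · simpa [extAngle, h] using contDiff_const

theorem volLam_univ (ν : Fin d → ℝ) :
    volLam ν Set.univ = (μHE[dimLam ν] : Measure (CP d)) (Lam ν) := by
  have := (isometry_subtype_coe (s := Lam ν)).euclideanHausdorffMeasure_image
    (d := dimLam ν) Set.univ
  rw [Set.image_univ, Subtype.range_coe] at this
  exact this.symm

section
variable {ν : Fin d → ℝ} {z : E d} {j₀ : Fin (d + 1)}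

/-- The dimension of `Λ_ν` is the number of the angles that parametrize it, which are those of the
nonzero coordinates except one. -/
theorem finrank_angles (hzL : z ∈ cone (Lam ν)) (hj₀ : z j₀ ≠ 0) :
    Module.finrank ℝ ({j // z j ≠ 0 ∧ j ≠ j₀} → ℝ) = dimLam ν := by
  classical
  rw [Module.finrank_fintype_fun_eq_card, Fintype.card_subtype, dimLam]
  have h1 : (Finset.univ.filter fun j => z j ≠ 0 ∧ j ≠ j₀) =
      (Finset.univ.filter fun j => z j ≠ 0).erase j₀ := by
    ext j
    simp [and_comm]
  rw [h1, Finset.card_erase_of_mem (by simpa using hj₀)]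
  congr 2
  ext j
  simpa [bary] using (bary_eq_zero_iff hzL j).not.symm

/-- `Λ_ν` is contained in the image of a cube under the parametrization by angles. -/
theorem Lam_subset (hz : ‖z‖ = 1) (hzL : z ∈ cone (Lam ν)) :
    Lam ν ⊆ (fun θ : {j // z j ≠ 0 ∧ j ≠ j₀} → ℝ =>
      Projectivization.mk ℂ (rot (extAngle θ) z) (rot_ne hzL.choose)) ''
      Metric.closedBall 0 Real.pi := by
  intro y hy
  obtain ⟨θ, h0, hπ, hz0, h, rfl⟩ := exists_rot hz hzL j₀ hy
  refine ⟨fun j => θ j, ?_, mk_congr ?_ _ _⟩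
  · rw [mem_closedBall_zero_iff, pi_norm_le_iff_of_nonneg Real.pi_pos.le]
    exact fun j => hπ j
  · congr 1
    funext j
    by_cases hj : z j ≠ 0 ∧ j ≠ j₀
    · simp [extAngle, hj]
    · rw [extAngle, dif_neg hj]
      by_cases hzj : z j = 0
      · exact (hz0 j hzj).symm
      · rw [not_and_or] at hj
        rw [not_not.1 (hj.resolve_left (by simpa using hzj)), h0]

end

instance (ν : Fin d → ℝ) : IsFiniteMeasure (volLam ν) := by
  refine ⟨?_⟩
  rw [volLam_univ]
  rcases (Lam ν).eq_empty_or_nonempty with h | h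
  · simp [h]
  obtain ⟨z, hz1, hzL⟩ := exists_unit_mem_cone h
  obtain ⟨j₀, hj⟩ := exists_norm_max z
  have hj₀ := coord_ne_of_max hzL.choose hj
  refine lt_of_le_of_lt (measure_mono (Lam_subset (j₀ := j₀) hz1 hzL)) ?_
  exact (euclideanHausdorffMeasure_image_ne_top (finrank_angles hzL hj₀) isometry_projEmb
    (contDiff_projEmb_comp ((contDiff_rot z).comp contDiff_extAngle) _)
    (isCompact_closedBall 0 _)).lt_top

/-- The sines of the angles relative to a nonzero coordinate are Lipschitz functions on `Λ_ν`, which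
together take all values in a cube. -/
theorem volLam_ne_zero {ν : Fin d → ℝ} (h : (Lam ν).Nonempty) : volLam ν Set.univ ≠ 0 := by
  rw [volLam_univ]
  obtain ⟨z, hz1, hzL⟩ := exists_unit_mem_cone h
  obtain ⟨j₀, hj⟩ := exists_norm_max z
  have hj₀ := coord_ne_of_max hzL.choose hj
  set κ := ((1 / Real.sqrt (2 * Real.pi) : ℝ) : ℂ) with hκ
  have hκ0 : κ ≠ 0 := by
    have : (0 : ℝ) < 1 / Real.sqrt (2 * Real.pi) := by positivity
    rw [hκ]
    exact_mod_cast this.ne'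
  let ψ : EuclideanSpace ℂ (Fin (d + 1) × Fin (d + 1)) → ({j // z j ≠ 0 ∧ j ≠ j₀} → ℝ) :=
    fun M i => (M (i, j₀) / (κ * (z i * (starRingEnd ℂ) (z j₀)))).im
  have hψ : ContDiff ℝ 1 ψ := by
    refine contDiff_pi.2 fun i => ?_
    have h : ContDiff ℝ 1 (fun M : EuclideanSpace ℂ (Fin (d + 1) × Fin (d + 1)) =>
        M (i.1, j₀) / (κ * (z i * (starRingEnd ℂ) (z j₀)))) :=
      (contDiff_piLp_apply (𝕜 := ℝ) 2).div_const _
    exact Complex.imCLM.contDiff.comp h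
  obtain ⟨C, hC⟩ := ((hψ.locallyLipschitz.locallyLipschitzOn
    (s := projEmb '' Lam ν))).exists_lipschitzOnWith_of_compact
      ((isClosed_Lam ν).isCompact.image isometry_projEmb.continuous)
  have hL : LipschitzOnWith C (ψ ∘ projEmb) (Lam ν) := fun a ha b hb => by
    have := hC (Set.mem_image_of_mem _ ha) (Set.mem_image_of_mem _ hb)
    rwa [isometry_projEmb.edist_eq] at this
  refine euclideanHausdorffMeasure_ne_zero (finrank_angles hzL hj₀) hL ⟨0, ?_⟩
  rw [mem_interior_iff_mem_nhds]
  filter_upwards [Metric.ball_mem_nhds (0 : {j // z j ≠ 0 ∧ j ≠ j₀} → ℝ) one_pos] with u hu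
  rw [mem_ball_zero_iff, pi_norm_lt_iff one_pos] at hu
  have hm := rot_mem_Lam hzL (extAngle fun j => Real.arcsin (u j))
  refine ⟨_, hm.choose_spec, ?_⟩
  funext i
  have hi0 := i.2.1
  have hsin : Real.sin (Real.arcsin (u i)) = u i := by
    have := abs_lt.1 (hu i)
    exact Real.sin_arcsin this.1.le this.2.le
  have he1 : extAngle (fun j => Real.arcsin (u j)) i = Real.arcsin (u i) := by
    simp [extAngle, i.2.1, i.2.2]
  have he2 : extAngle (fun j : {j // z j ≠ 0 ∧ j ≠ j₀} => Real.arcsin (u j)) j₀ = 0 := by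
    simp [extAngle]
  have hz0 : (starRingEnd ℂ) (z j₀) ≠ 0 := by simpa using hj₀
  have hcalc : projEmb (Projectivization.mk ℂ _ hm.choose) (i.1, j₀) /
      (κ * (z i * (starRingEnd ℂ) (z j₀))) = Complex.exp ((Real.arcsin (u i) : ℂ) * Complex.I) := by
    rw [projEmb_mk hm.choose]
    simp only [rot_apply, he1, he2, norm_rot, hz1, ← hκ]
    simp only [one_pow, Complex.ofReal_one, div_one, Complex.ofReal_zero, zero_mul,
      Complex.exp_zero, mul_one]
    field_simp
  change (projEmb (Projectivization.mk ℂ _ hm.choose) (i.1, j₀) /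
      (κ * (z i * (starRingEnd ℂ) (z j₀)))).im = u i
  rw [hcalc, Complex.exp_ofReal_mul_I_im, hsin]

variable {m : ℤ}

/-! ### Holomorphic sections -/

theorem contDiffAt_zpow {𝕜 : Type*} [NontriviallyNormedField 𝕜] [NormedAlgebra 𝕜 ℂ] {z : ℂ}
    (hz : z ≠ 0) (m : ℤ) : ContDiffAt 𝕜 ∞ (fun z : ℂ => z ^ m) z :=
  (analyticAt_id.zpow hz).contDiffAt

theorem isOpen_compl_zero : IsOpen ({0}ᶜ : Set (E d)) := isOpen_compl_singleton

theorem H0.differentiableAt {s : Sec d m} (hs : s ∈ H0 d m) {v : E d} (hv : v ≠ 0) :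
    DifferentiableAt ℂ (lift s) v :=
  DifferentiableOn.differentiableAt (s := {0}ᶜ) hs (isOpen_compl_zero.mem_nhds hv)

theorem H0.continuousOn {s : Sec d m} (hs : s ∈ H0 d m) : ContinuousOn (lift s) {0}ᶜ :=
  DifferentiableOn.continuousOn (𝕜 := ℂ) hs

/-- The homogeneous function of a continuous section is bounded by its maximum on the sphere. -/
theorem exists_bound_lift {s : Sec d m} (hs : ContinuousOn (lift s) {0}ᶜ) :
    ∃ C : ℝ, 0 ≤ C ∧ ∀ v : E d, v ≠ 0 → ‖lift s v‖ ≤ C * ‖v‖ ^ m := by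
  obtain ⟨C, hC⟩ := (isCompact_sphere (0 : E d) 1).exists_bound_of_continuousOn
    (hs.mono fun v hv => ne_zero_of_mem_unit_sphere ⟨v, hv⟩)
  refine ⟨max C 0, le_max_right _ _, fun v hv => ?_⟩
  obtain ⟨c, hc, w, hw, rfl⟩ : ∃ c : ℂ, c ≠ 0 ∧ ∃ w : E d, ‖w‖ = 1 ∧ v = c • w := by
    have hn : ‖v‖ ≠ 0 := norm_ne_zero_iff.2 hv
    have hn' : (‖v‖ : ℂ) ≠ 0 := Complex.ofReal_ne_zero.2 hn
    refine ⟨‖v‖, hn', (‖v‖ : ℂ)⁻¹ • v, ?_, (smul_inv_smul₀ hn' v).symm⟩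
    rw [norm_smul, norm_inv, Complex.norm_real, norm_norm, inv_mul_cancel₀ hn]
  rw [lift_smul s hc, norm_mul, norm_zpow, norm_smul, hw, mul_one, mul_comm]
  exact mul_le_mul_of_nonneg_right ((hC w (by simpa using hw)).trans (le_max_left _ _))
    (zpow_nonneg (norm_nonneg _) _)

theorem chartVec_update (j : Fin (d + 1)) (z : Fin d → ℂ) (i : Fin d) (t : ℂ) :
    chartVec j (Function.update z i t) =
      chartVec j (Function.update z i 0) + t • EuclideanSpace.single (j.succAbove i) (1 : ℂ) := by
  ext l
  rcases Fin.eq_self_or_eq_succAbove j l with rfl | ⟨k, rfl⟩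
  · simp [(Fin.succAbove_ne _ _).symm]
  · by_cases hk : k = i
    · subst hk; simp
    · simp [hk]

theorem one_le_norm_chartVec (j : Fin (d + 1)) (z : Fin d → ℂ) : 1 ≤ ‖chartVec j z‖ := by
  have := PiLp.norm_apply_le (chartVec j z) j
  simpa using this

/-- In an affine chart, a holomorphic section of `L^m` is a polynomial: it is entire and of
polynomial growth in each coordinate. -/
theorem H0.sepGrowth {s : Sec d m} (hs : s ∈ H0 d m) (j : Fin (d + 1)) :
    SepGrowth m.toNat fun z => lift s (chartVec j z) := by
  intro z i
  constructor
  · intro t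
    have h : Differentiable ℂ fun t => chartVec j (Function.update z i t) := by
      rw [show (fun t => chartVec j (Function.update z i t)) = _ from
        funext fun t => chartVec_update j z i t]
      fun_prop
    exact DifferentiableAt.comp (g := lift s) t (H0.differentiableAt hs (chartVec_ne _ _)) (h t)
  · obtain ⟨C, hC0, hC⟩ := exists_bound_lift (H0.continuousOn hs)
    set A := ‖chartVec j (Function.update z i 0)‖
    refine ⟨C * (A + 1) ^ m.toNat, fun t => ?_⟩
    have h1 := one_le_norm_chartVec j (Function.update z i t)
    have h2 : ‖chartVec j (Function.update z i t)‖ ≤ (A + 1) * (1 + ‖t‖) := by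
      rw [chartVec_update]
      refine (norm_add_le _ _).trans ?_
      rw [norm_smul, PiLp.norm_single, norm_one, mul_one]
      have : 0 ≤ A := norm_nonneg _
      nlinarith [norm_nonneg t]
    calc ‖lift s (chartVec j (Function.update z i t))‖
        ≤ C * ‖chartVec j (Function.update z i t)‖ ^ m := hC _ (chartVec_ne _ _)
      _ ≤ C * ‖chartVec j (Function.update z i t)‖ ^ (m.toNat : ℤ) := by
          gcongr
          exact Int.self_le_toNat m
      _ ≤ C * ((A + 1) * (1 + ‖t‖)) ^ m.toNat := by
          rw [zpow_natCast]
          gcongr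
      _ = _ := by rw [mul_pow]; ring

theorem lift_eq_chart (s : Sec d m) {v : E d} {j : Fin (d + 1)} (hj : v j ≠ 0) :
    lift s v = v j ^ m * lift s (chartVec j fun i => v (j.succAbove i) / v j) := by
  conv_lhs => rw [eq_smul_chartVec hj]
  exact lift_smul s hj _

/-- The homogeneous function of a holomorphic section is smooth: this is read off in affine charts,
where it is polynomial. -/
theorem H0.contDiffOn {s : Sec d m} (hs : s ∈ H0 d m) : ContDiffOn ℝ ∞ (lift s) {0}ᶜ := by
  intro v hv
  refine ContDiffAt.contDiffWithinAt ?_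
  obtain ⟨j, hj⟩ := exists_norm_max v
  have hj0 := coord_ne_of_max hv hj
  have hcoord : ∀ i, ContDiffAt ℂ ∞ (fun w : E d => w i) v := fun i =>
    (contDiff_piLp_apply (𝕜 := ℂ) 2).contDiffAt
  have h : ContDiffAt ℂ ∞ (fun w : E d =>
      w j ^ m * lift s (chartVec j fun i => w (j.succAbove i) / w j)) v := by
    refine ((contDiffAt_zpow hj0 m).comp v (hcoord j)).mul ?_
    refine ContDiffAt.comp v (g := fun z => lift s (chartVec j z))
      (H0.sepGrowth hs j).contDiff.contDiffAt ?_
    exact contDiffAt_pi.2 fun i => (hcoord _).div (hcoord j) hj0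
  refine (h.restrict_scalars ℝ).congr_of_eventuallyEq ?_
  filter_upwards [(hcoord j).continuousAt.eventually_ne hj0] with w hw
  exact lift_eq_chart s hw

theorem finiteDimensional_of_ker {F G : Type*} [AddCommGroup F] [Module ℂ F] [AddCommGroup G]
    [Module ℂ G] [FiniteDimensional ℂ G] (Φ : F →ₗ[ℂ] G) (h : ∀ x, Φ x = 0 → x = 0) :
    FiniteDimensional ℂ F :=
  FiniteDimensional.of_injective Φ (LinearMap.ker_eq_bot.1 (LinearMap.ker_eq_bot'.2 h))

/-- Evaluation of holomorphic sections at a family of vectors. -/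
def evalAt {ι : Type*} (a : ι → E d) : H0 d m →ₗ[ℂ] (ι → ℂ) where
  toFun s i := lift s.1 (a i)
  map_add' _ _ := funext fun _ => lift_add _ _ _
  map_smul' _ _ := funext fun _ => lift_const_smul _ _ _

/-- A holomorphic section is determined by its values on a finite grid in each affine chart. -/
instance : FiniteDimensional ℂ (H0 d m) := by
  refine finiteDimensional_of_ker (evalAt fun ja : Fin (d + 1) × (Fin d → Fin (m.toNat + 1)) =>
    chartVec ja.1 fun i => ((ja.2 i : ℕ) : ℂ)) fun s hs => ?_
  refine Subtype.ext (sec_ext fun v hv => ?_)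
  obtain ⟨j, hj⟩ := exists_norm_max v
  rw [lift_eq_chart s.1 (coord_ne_of_max hv hj),
    (H0.sepGrowth s.2 j).eq_zero fun a => congrFun hs (j, a)]
  simp

/-! ### The Hermitian product of sections -/

/-- The Hermitian metric as a linear form in the first variable. -/
def hermRight {x : CP d} (ψ : Fib m x) : Fib m x →ₗ[ℂ] ℂ where
  toFun φ := herm φ ψ
  map_add' φ φ' := by
    simp only [herm, Submodule.coe_add, Pi.add_apply]
    ring
  map_smul' a φ := by
    simp only [herm, Submodule.coe_smul, Pi.smul_apply, smul_eq_mul, RingHom.id_apply]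
    ring

theorem hermRight_apply {x : CP d} (φ ψ : Fib m x) : hermRight ψ φ = herm φ ψ := rfl

theorem conj_herm {x : CP d} (φ ψ : Fib m x) : (starRingEnd ℂ) (herm φ ψ) = herm ψ φ := by
  simp only [herm, map_div₀, map_mul, Complex.conj_conj, Complex.conj_ofReal]
  ring

theorem herm_self {x : CP d} (φ : Fib m x) :
    herm φ φ = ((‖φ.1 x.rep‖ ^ 2 / ‖x.rep‖ ^ (2 * m) : ℝ) : ℂ) := by
  rw [herm, Complex.mul_conj, Complex.normSq_eq_norm_sq, ← Complex.ofReal_div]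

theorem continuousOn_norm_zpow (k : ℤ) :
    ContinuousOn (fun v : E d => ((‖v‖ ^ k : ℝ) : ℂ)) {0}ᶜ :=
  Complex.continuous_ofReal.comp_continuousOn
    (continuous_norm.continuousOn.zpow₀ k fun _ hv => Or.inl (norm_ne_zero_iff.2 hv))

theorem norm_zpow_ne {v : E d} (hv : v ≠ 0) (k : ℤ) : ((‖v‖ ^ k : ℝ) : ℂ) ≠ 0 :=
  Complex.ofReal_ne_zero.2 (zpow_ne_zero _ (norm_ne_zero_iff.2 hv))

theorem continuous_herm {s t : Sec d m} (hs : ContinuousOn (lift s) {0}ᶜ)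
    (ht : ContinuousOn (lift t) {0}ᶜ) : Continuous fun x => herm (s x) (t x) :=
  continuous_of_lift ((hs.mul (Complex.continuous_conj.comp_continuousOn ht)).div
    (continuousOn_norm_zpow _) fun _ hv => norm_zpow_ne hv _) fun _ hv => (herm_lift s t hv).symm

theorem integrable_volX {g : CP d → ℂ} (hg : Continuous g) : Integrable g (volX d) :=
  hg.integrable_of_hasCompactSupport (HasCompactSupport.of_compactSpace g)

/-- A continuous nonnegative function with zero integral vanishes, as `dv_X` is positive on open
sets. -/
theorem eq_zero_of_integral_eq_zero {g : CP d → ℂ} (hg : Continuous g)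
    (h0 : ∀ x, g x = ((g x).re : ℂ) ∧ 0 ≤ (g x).re) (hi : ∫ x, g x ∂(volX d) = 0) (x : CP d) :
    g x = 0 := by
  have h1 : ∫ x, (g x).re ∂(volX d) = 0 := by
    have : ∫ x, (g x).re ∂(volX d) = (∫ x, g x ∂(volX d)).re := integral_re (integrable_volX hg)
    rw [this, hi, Complex.zero_re]
  have hc : Continuous fun x => (g x).re := Complex.continuous_re.comp hg
  rw [integral_eq_zero_iff_of_nonneg (fun x => (h0 x).2) (integrable_volX hg).re] at h1
  have h2 := (hc.ae_eq_iff_eq (volX d) continuous_const).1 h1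
  rw [(h0 x).1, show (g x).re = 0 from congrFun h2 x, Complex.ofReal_zero]

theorem conj_innerL2 (s t : Sec d m) : (starRingEnd ℂ) (innerL2 s t) = innerL2 t s := by
  rw [innerL2, ← integral_conj]
  simp_rw [conj_herm]
  rfl

theorem innerL2_smul_left (a : ℂ) (s t : Sec d m) : innerL2 (a • s) t = a * innerL2 s t := by
  rw [innerL2, innerL2, ← integral_const_mul]
  congr 1
  funext x
  exact (hermRight (t x)).map_smul a (s x)

theorem innerL2_add_left {s s' t : Sec d m} (hs : ContinuousOn (lift s) {0}ᶜ)
    (hs' : ContinuousOn (lift s') {0}ᶜ) (ht : ContinuousOn (lift t) {0}ᶜ) :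
    innerL2 (s + s') t = innerL2 s t + innerL2 s' t := by
  rw [innerL2, innerL2, innerL2, ← integral_add (integrable_volX (continuous_herm hs ht))
    (integrable_volX (continuous_herm hs' ht))]
  congr 1
  funext x
  exact (hermRight (t x)).map_add (s x) (s' x)

theorem innerL2_sum_left {ι : Type*} (S : Finset ι) (a : ι → ℂ) {s : ι → Sec d m} {t : Sec d m}
    (hs : ∀ i, s i ∈ H0 d m) (ht : t ∈ H0 d m) :
    innerL2 (∑ i ∈ S, a i • s i) t = ∑ i ∈ S, a i * innerL2 (s i) t := by
  classical
  induction S using Finset.induction_on with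
  | empty =>
    simp only [Finset.sum_empty]
    simpa using innerL2_smul_left 0 (0 : Sec d m) t
  | insert i S hi ih =>
    rw [Finset.sum_insert hi, Finset.sum_insert hi, innerL2_add_left
      (H0.continuousOn ((H0 d m).smul_mem _ (hs i)))
      (H0.continuousOn (Submodule.sum_mem _ fun i _ => (H0 d m).smul_mem _ (hs i)))
      (H0.continuousOn ht), ih, innerL2_smul_left]

theorem eq_zero_of_innerL2_self {s : Sec d m} (hs : ContinuousOn (lift s) {0}ᶜ)
    (h : innerL2 s s = 0) : s = 0 := by
  have := eq_zero_of_integral_eq_zero (continuous_herm hs hs) (fun x => by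
    rw [herm_self, Complex.ofReal_re]
    exact ⟨rfl, div_nonneg (sq_nonneg _) (zpow_nonneg (norm_nonneg _) _)⟩) h
  refine sec_ext fun v hv => ?_
  have h1 := this (Projectivization.mk ℂ v hv)
  rw [herm_lift s s hv, div_eq_zero_iff, or_iff_left (norm_zpow_ne hv _)] at h1
  simpa using h1

/-- A sesquilinear positive definite form on a finite-dimensional space has an orthonormal basis. -/
theorem exists_orthonormal_expansion {F : Type*} [AddCommGroup F] [Module ℂ F]
    [FiniteDimensional ℂ F] (B : F → F → ℂ) (hadd : ∀ x y z, B (x + y) z = B x z + B y z)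
    (hsmul : ∀ (a : ℂ) x z, B (a • x) z = a * B x z)
    (hconj : ∀ x y, (starRingEnd ℂ) (B x y) = B y x) (hpos : ∀ x, 0 ≤ (B x x).re)
    (hdef : ∀ x, B x x = 0 → x = 0) :
    ∃ (n : ℕ) (e : Fin n → F), ∀ x, x = ∑ i, B x (e i) • e i := by
  let core : InnerProductSpace.Core ℂ F :=
    { inner := fun x y => B y x
      conj_inner_symm := fun x y => hconj x y
      re_inner_nonneg := fun x => hpos x
      add_left := fun x y z => by
        change B z (x + y) = B z x + B z y
        rw [← hconj, hadd, map_add, hconj, hconj]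
      smul_left := fun x y r => by
        change B y (r • x) = _ * B y x
        rw [← hconj, hsmul, map_mul, hconj]
      definite := fun x hx => hdef x hx }
  let _ : NormedAddCommGroup F := core.toNormedAddCommGroup
  let _ : InnerProductSpace ℂ F := InnerProductSpace.ofCore core.toCore
  let b := stdOrthonormalBasis ℂ F
  exact ⟨_, b, fun x => (b.sum_repr' x).symm⟩

/-- A finite family of holomorphic sections with respect to which every holomorphic section has
the Fourier expansion `t = ∑ ⟨t, e_i⟩ e_i`, such as an orthonormal basis. -/
structure IsFrame {n : ℕ} (e : Fin n → Sec d m) : Prop where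
  mem : ∀ i, e i ∈ H0 d m
  expansion : ∀ t ∈ H0 d m, t = ∑ i, innerL2 t (e i) • e i

theorem innerL2_self_nonneg {s : Sec d m} (hs : ContinuousOn (lift s) {0}ᶜ) :
    0 ≤ (innerL2 s s).re := by
  have h : ∫ y, (herm (s y) (s y)).re ∂(volX d) = (innerL2 s s).re :=
    integral_re (integrable_volX (continuous_herm hs hs))
  rw [← h]
  refine integral_nonneg fun y => ?_
  simp only [Pi.zero_apply, herm_self, Complex.ofReal_re]
  exact div_nonneg (sq_nonneg _) (zpow_nonneg (norm_nonneg _) _)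

theorem H0.exists_expansion (d : ℕ) (m : ℤ) :
    ∃ (n : ℕ) (e : Fin n → H0 d m), ∀ t : H0 d m, t = ∑ i, innerL2 t.1 (e i).1 • e i :=
  exists_orthonormal_expansion (F := H0 d m) (fun s t => innerL2 s.1 t.1)
    (fun x y z => innerL2_add_left (H0.continuousOn x.2) (H0.continuousOn y.2)
      (H0.continuousOn z.2))
    (fun a x z => innerL2_smul_left a x.1 z.1) (fun x y => conj_innerL2 x.1 y.1)
    (fun x => innerL2_self_nonneg (H0.continuousOn x.2))
    (fun x hx => Subtype.ext (eq_zero_of_innerL2_self (H0.continuousOn x.2) hx))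

theorem exists_isFrame (d : ℕ) (m : ℤ) : ∃ (n : ℕ) (e : Fin n → Sec d m), IsFrame e := by
  obtain ⟨n, e, he⟩ := H0.exists_expansion d m
  refine ⟨n, fun i => (e i).1, fun i => (e i).2, fun t ht => ?_⟩
  have := congrArg (H0 d m).subtype (he ⟨t, ht⟩)
  rw [map_sum] at this
  exact this

/-! ### The Bergman kernel -/

/-- The kernel `∑ e_i(x) ⊗ e_i(y)^*`. -/
def frameKer {n : ℕ} (e : Fin n → Sec d m) : Ker d m := fun x y =>
  ∑ i, (hermRight (e i y)).smulRight (e i x)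

theorem frameKer_apply {n : ℕ} (e : Fin n → Sec d m) (x y : CP d) (φ : Fib m y) :
    frameKer e x y φ = ∑ i, herm φ (e i y) • e i x := by
  simp [frameKer, hermRight_apply]

theorem frameKer_apply_val {n : ℕ} (e : Fin n → Sec d m) (x y : CP d) (φ : Fib m y) (v : E d) :
    (frameKer e x y φ).1 v = ∑ i, herm φ (e i y) * (e i x).1 v := by
  rw [frameKer_apply]
  simp

/-- The kernel of a frame, integrated against a field `g` of elements of fibres of `L^m`, is a
combination of the sections of the frame. -/
theorem fibIntegral_frameKer {n : ℕ} (e : Fin n → Sec d m) {α : Type*} [MeasurableSpace α]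
    (μ : Measure α) (q : α → CP d) (g : ∀ a, Fib m (q a))
    (hg : ∀ i, Integrable (fun a => herm (g a) (e i (q a))) μ) (x : CP d) :
    fibIntegral μ (fun a => frameKer e x (q a) (g a)) =
      (∑ i, (∫ a, herm (g a) (e i (q a)) ∂μ) • e i) x := by
  ext v
  change ∫ a, (frameKer e x (q a) (g a)).1 v ∂μ = _
  simp_rw [frameKer_apply_val]
  rw [integral_finsetSum _ fun i _ => (hg i).mul_const _]
  simp [integral_mul_const]

/-- The expansion of a holomorphic section in a frame, paired with an element of a fibre. -/
theorem herm_eq_sum_frame {n : ℕ} {e : Fin n → Sec d m} (he : IsFrame e) {t : Sec d m}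
    (ht : t ∈ H0 d m) {y : CP d} (φ : Fib m y) :
    herm φ (t y) = ∑ i, innerL2 (e i) t * herm φ (e i y) := by
  have h1 : t y = ∑ i, innerL2 t (e i) • e i y := by
    conv_lhs => rw [he.expansion t ht]
    simp
  rw [← conj_herm, ← hermRight_apply, h1, map_sum, map_sum]
  refine Finset.sum_congr rfl fun i _ => ?_
  rw [map_smul, smul_eq_mul, map_mul, conj_innerL2, hermRight_apply, conj_herm]

/-- The pairing of a smeared kernel with a holomorphic section: the reproducing property. -/
theorem innerL2_frame {n : ℕ} {e : Fin n → Sec d m} (he : IsFrame e) {α : Type*}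
    [MeasurableSpace α] (μ : Measure α) (q : α → CP d) (g : ∀ a, Fib m (q a))
    (hg : ∀ i, Integrable (fun a => herm (g a) (e i (q a))) μ) {t : Sec d m} (ht : t ∈ H0 d m) :
    innerL2 (∑ i, (∫ a, herm (g a) (e i (q a)) ∂μ) • e i) t = ∫ a, herm (g a) (t (q a)) ∂μ := by
  rw [innerL2_sum_left _ _ he.mem ht]
  simp_rw [herm_eq_sum_frame he ht]
  rw [integral_finsetSum _ fun i _ => (hg i).const_mul _]
  refine Finset.sum_congr rfl fun i _ => ?_
  rw [integral_const_mul, mul_comm]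

theorem frameKer_smooth {n : ℕ} {e : Fin n → Sec d m} (he : IsFrame e) : (frameKer e).Smooth := by
  refine ⟨fun q => ∑ i, lift (e i) q.1 *
    ((starRingEnd ℂ) (lift (e i) q.2) * (((‖q.2‖ ^ 2 : ℝ) : ℂ) ^ m)⁻¹), ?_, ?_⟩
  · refine ContDiffOn.sum fun i _ => ?_
    have h1 : ContDiffOn ℝ ∞ (fun q : E d × E d => lift (e i) q.1) {q | q.1 ≠ 0 ∧ q.2 ≠ 0} :=
      (H0.contDiffOn (he.mem i)).comp contDiff_fst.contDiffOn fun q hq => hq.1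
    have h2 : ContDiffOn ℝ ∞ (fun q : E d × E d => lift (e i) q.2) {q | q.1 ≠ 0 ∧ q.2 ≠ 0} :=
      (H0.contDiffOn (he.mem i)).comp contDiff_snd.contDiffOn fun q hq => hq.2
    refine h1.mul ((Complex.conjCLE.contDiff.comp_contDiffOn h2).mul ?_)
    intro q hq
    have hq2 : ((‖q.2‖ ^ 2 : ℝ) : ℂ) ≠ 0 :=
      Complex.ofReal_ne_zero.2 (pow_ne_zero 2 (norm_ne_zero_iff.2 hq.2))
    exact (((contDiffAt_zpow hq2 m).comp q
      ((contDiff_norm_sq_ofReal.comp contDiff_snd).contDiffAt)).inv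
        (zpow_ne_zero _ hq2)).contDiffWithinAt
  · intro v w hv hw φ
    rw [frameKer_apply_val, Finset.sum_mul]
    refine Finset.sum_congr rfl fun i _ => ?_
    rw [herm_eq hw rfl, lift_of_ne _ hv, lift_of_ne _ hw, zpow_mul]
    push_cast
    rw [div_eq_mul_inv]
    norm_cast
    ring

theorem frameKer_isBergmanKernel {n : ℕ} {e : Fin n → Sec d m} (he : IsFrame e) :
    IsBergmanKernel m (frameKer e) := by
  refine ⟨frameKer_smooth he, fun s hs => ?_⟩
  have hsc : ContinuousOn (lift s) {0}ᶜ := ContDiffOn.continuousOn (𝕜 := ℝ) hs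
  have hi : ∀ i, Integrable (fun y => herm (s y) (e i y)) (volX d) := fun i =>
    integrable_volX (continuous_herm hsc (H0.continuousOn (he.mem i)))
  have hop : (frameKer e).op s = ∑ i, (∫ y, herm (s y) (e i y) ∂(volX d)) • e i :=
    funext fun x => fibIntegral_frameKer e (volX d) id s hi x
  rw [hop]
  exact ⟨Submodule.sum_mem _ fun i _ => Submodule.smul_mem _ _ (he.mem i),
    fun t ht => innerL2_frame he (volX d) id s hi ht⟩

/-- The kernel `P` is given by the function `K` on `(ℂⁿ ∖ {0})²`. -/
def Ker.IsGivenBy (P : Ker d m) (K : E d × E d → ℂ) : Prop :=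
  ∀ (v w : E d) (hv : v ≠ 0) (hw : w ≠ 0) (φ : Fib m (Projectivization.mk ℂ w hw)),
    (P (Projectivization.mk ℂ v hv) (Projectivization.mk ℂ w hw) φ).1 v = K (v, w) * φ.1 w

theorem Ker.IsGivenBy.apply_sec {P : Ker d m} {K : E d × E d → ℂ}
    (hK : P.IsGivenBy K)
    (s : Sec d m) {v w : E d} (hv : v ≠ 0) (hw : w ≠ 0) :
    (P (Projectivization.mk ℂ v hv) (Projectivization.mk ℂ w hw) (s _)).1 v =
      K (v, w) * lift s w := by
  rw [hK v w hv hw, lift_of_ne s hw]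

/-- A section of `L^m` that does not vanish at the line of `w`. -/
def peak (m : ℤ) (w : E d) : Sec d m := ofFun m (fun u => (inner ℂ w u) ^ m) fun c _ u _ => by
  rw [inner_smul_right, mul_zpow]

theorem lift_peak_ne (m : ℤ) {w : E d} (hw : w ≠ 0) : lift (peak m w) w ≠ 0 := by
  rw [peak, lift_ofFun _ hw]
  exact zpow_ne_zero _ (inner_self_ne_zero.2 hw)

/-- The function giving a kernel on `L^m` is homogeneous of degree `-m` in its second variable. -/
theorem Ker.IsGivenBy.smul_right {P : Ker d m} {K : E d × E d → ℂ}
    (hK : P.IsGivenBy K)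
    {v w : E d} (hv : v ≠ 0) (hw : w ≠ 0) {c : ℂ} (hc : c ≠ 0) :
    K (v, w) = c ^ m * K (v, c • w) := by
  have h1 := Ker.IsGivenBy.apply_sec hK (peak m w) hv hw
  have h2 := Ker.IsGivenBy.apply_sec hK (peak m w) hv (smul_ne_zero hc hw)
  rw [mk_smul hw hc, h1, lift_smul _ hc] at h2
  refine mul_right_cancel₀ (lift_peak_ne m hw) (h2.trans ?_)
  ring

/-- Both kernels give the orthogonal projection of a smooth section to `H⁰(X, L^m)`. -/
theorem op_eq_of_isBergmanKernel {P Q : Ker d m} (hP : IsBergmanKernel m P)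
    (hQ : IsBergmanKernel m Q) {s : Sec d m} (hs : IsSmooth s) : P.op s = Q.op s := by
  obtain ⟨hP1, hP2⟩ := hP.2 s hs
  obtain ⟨hQ1, hQ2⟩ := hQ.2 s hs
  have hmem := (H0 d m).sub_mem hP1 hQ1
  refine sub_eq_zero.1 (eq_zero_of_innerL2_self (H0.continuousOn hmem) ?_)
  have hneg := (H0 d m).smul_mem (-1) hQ1
  rw [sub_eq_add_neg, ← neg_one_smul ℂ (Q.op s)] at hmem ⊢
  rw [innerL2_add_left (H0.continuousOn hP1) (H0.continuousOn hneg) (H0.continuousOn hmem),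
    innerL2_smul_left, hP2 _ hmem, hQ2 _ hmem]
  ring

/-- Uniqueness of the Bergman kernel: the difference of two Bergman kernels annihilates all smooth
sections, in particular the one conjugate to it. -/
theorem eq_of_isBergmanKernel {P Q : Ker d m} (hP : IsBergmanKernel m P)
    (hQ : IsBergmanKernel m Q) : P = Q := by
  obtain ⟨K, hKs, hK⟩ := hP.1
  obtain ⟨K', hKs', hK'⟩ := hQ.1
  suffices H : ∀ v w : E d, v ≠ 0 → w ≠ 0 → K (v, w) - K' (v, w) = 0 by
    funext x y
    induction x using Projectivization.ind with
    | h v hv =>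
      induction y using Projectivization.ind with
      | h w hw =>
        refine LinearMap.ext fun φ => Fib.ext_mk hv ?_
        rw [hK, hK', sub_eq_zero.1 (H v w hv hw)]
  intro v w hv hw
  -- The difference of the two kernels at a fixed `v`, and the section `F` conjugate to it: the
  -- integral of their product is that of a nonnegative function.
  let D : E d → ℂ := fun w => K (v, w) - K' (v, w)
  have hD : ContDiffOn ℝ ∞ D {0}ᶜ := by
    have h : ContDiffOn ℝ ∞ (fun w : E d => (v, w)) {0}ᶜ :=
      (contDiff_const.prodMk contDiff_id).contDiffOn
    exact (hKs.comp h fun w hw => ⟨hv, hw⟩).sub (hKs'.comp h fun w hw => ⟨hv, hw⟩)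
  have hDc : ∀ c : ℂ, c ≠ 0 → ∀ w, w ≠ 0 → D w = c ^ m * D (c • w) := by
    intro c hc w hw
    simp only [D]
    rw [Ker.IsGivenBy.smul_right hK hv hw hc, Ker.IsGivenBy.smul_right hK' hv hw hc, mul_sub]
  let F : E d → ℂ := fun w => (starRingEnd ℂ) (D w) * ((‖w‖ ^ 2 : ℝ) : ℂ) ^ m
  have hF : ∀ c : ℂ, c ≠ 0 → ∀ w, w ≠ 0 → F (c • w) = c ^ m * F w := by
    intro c hc w hw
    have h1 : ((‖c‖ ^ 2 : ℝ) : ℂ) = c * (starRingEnd ℂ) c := by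
      rw [Complex.mul_conj, Complex.normSq_eq_norm_sq]
    simp only [F]
    rw [hDc c hc w hw, norm_smul, mul_pow, Complex.ofReal_mul, h1, mul_zpow, mul_zpow, map_mul,
      map_zpow₀]
    ring
  let s := ofFun m F hF
  have hsF : ∀ w, w ≠ 0 → lift s w = F w := fun w hw => lift_ofFun hF hw
  have hs : IsSmooth s := by
    refine ContDiffOn.congr (f := F) ?_ fun w hw => hsF w hw
    refine (Complex.conjCLE.contDiff.comp_contDiffOn hD).mul fun w hw => ?_
    have hw2 : ((‖w‖ ^ 2 : ℝ) : ℂ) ≠ 0 :=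
      Complex.ofReal_ne_zero.2 (pow_ne_zero 2 (norm_ne_zero_iff.2 hw))
    exact ((contDiffAt_zpow hw2 m).comp w contDiff_norm_sq_ofReal.contDiffAt).contDiffWithinAt
  have hsc : ContinuousOn (lift s) {0}ᶜ := ContDiffOn.continuousOn (𝕜 := ℝ) hs
  have hcont : ∀ {P : Ker d m} {K : E d × E d → ℂ},
      ContDiffOn ℝ ∞ K {q | q.1 ≠ 0 ∧ q.2 ≠ 0} →
      P.IsGivenBy K →
      Continuous fun y => (P (Projectivization.mk ℂ v hv) y (s y)).1 v := by
    intro P K hKs hK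
    refine continuous_of_lift (h := fun w => K (v, w) * lift s w) ?_ fun w hw =>
      (Ker.IsGivenBy.apply_sec hK s hv hw).symm
    exact (hKs.continuousOn.comp (by fun_prop) fun w hw => ⟨hv, hw⟩).mul hsc
  have hgP := hcont hKs hK
  have hgQ := hcont hKs' hK'
  have hval : ∀ w (hw : w ≠ 0), (P (Projectivization.mk ℂ v hv) (Projectivization.mk ℂ w hw)
      (s _)).1 v - (Q (Projectivization.mk ℂ v hv) (Projectivization.mk ℂ w hw) (s _)).1 v =
      ((‖D w‖ ^ 2 * (‖w‖ ^ 2) ^ m : ℝ) : ℂ) := by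
    intro w hw
    rw [Ker.IsGivenBy.apply_sec hK s hv hw, Ker.IsGivenBy.apply_sec hK' s hv hw, ← sub_mul,
      hsF w hw]
    change D w * ((starRingEnd ℂ) (D w) * _) = _
    rw [← mul_assoc, Complex.mul_conj, Complex.normSq_eq_norm_sq]
    push_cast
    rfl
  have hint : ∫ y, ((P (Projectivization.mk ℂ v hv) y (s y)).1 v -
      (Q (Projectivization.mk ℂ v hv) y (s y)).1 v) ∂(volX d) = 0 := by
    rw [integral_sub (integrable_volX hgP) (integrable_volX hgQ), sub_eq_zero]
    exact congrFun (congrArg Subtype.val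
      (congrFun (op_eq_of_isBergmanKernel hP hQ hs) (Projectivization.mk ℂ v hv))) v
  have hg0 := eq_zero_of_integral_eq_zero (hgP.sub hgQ) (fun y => by
    induction y using Projectivization.ind with
    | h w hw =>
      rw [Pi.sub_apply, hval w hw, Complex.ofReal_re]
      exact ⟨rfl, by positivity⟩) hint (Projectivization.mk ℂ w hw)
  rw [Pi.sub_apply, hval w hw, Complex.ofReal_eq_zero, mul_eq_zero] at hg0
  rcases hg0 with h | h
  · exact norm_eq_zero.1 (pow_eq_zero_iff two_ne_zero |>.1 h)
  · exact absurd h (zpow_ne_zero _ (pow_ne_zero 2 (norm_ne_zero_iff.2 hw)))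

/-- The Bergman kernel is the kernel `∑ e_i(x) ⊗ e_i(y)^*` of any frame. -/
theorem bergman_eq_frameKer {n : ℕ} {e : Fin n → Sec d m} (he : IsFrame e) :
    bergman d m = frameKer e :=
  eq_of_isBergmanKernel (Classical.epsilon_spec ⟨_, frameKer_isBergmanKernel he⟩)
    (frameKer_isBergmanKernel he)

/-! ### The action of the torus -/

/-- The angles `2π ξ_j` of `e^ξ`. -/
def ang (ξ : Fin d → ℝ) : Fin (d + 1) → ℝ := fun j =>
  2 * Real.pi * (Fin.cons 0 ξ : Fin (d + 1) → ℝ) j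

theorem exists_ang {θ : Fin (d + 1) → ℝ} (h : θ 0 = 0) : ∃ ξ, ang ξ = θ := by
  refine ⟨fun j => θ j.succ / (2 * Real.pi), funext fun j => ?_⟩
  refine Fin.cases ?_ (fun j => ?_) j
  · simp [ang, h]
  · simp only [ang, Fin.cons_succ]
    field_simp

theorem rot_rot (θ θ' : Fin (d + 1) → ℝ) (v : E d) : rot θ (rot θ' v) = rot (θ + θ') v := by
  ext j
  simp only [rot_apply, Pi.add_apply, Complex.ofReal_add, add_mul, Complex.exp_add]
  ring

@[simp] theorem rot_zero (v : E d) : rot 0 v = v := by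
  ext j
  simp

theorem cj_expT (ξ : Fin d → ℝ) (v : E d) : cj (expT ξ) v = rot (-ang ξ) v := by
  ext j
  simp only [cj, expT, rot_apply, Matrix.toLpLin_apply, Pi.neg_apply, ang]
  rw [Matrix.diagonal_map (map_zero _), Matrix.mulVec_diagonal, ← Complex.exp_conj, mul_comm]
  congr 2
  simp only [map_mul, Complex.conj_ofReal, Complex.conj_I, Complex.conj_ofNat]
  push_cast
  ring

theorem cj_expT_inv (ξ : Fin d → ℝ) (v : E d) : cj (expT ξ)⁻¹ v = rot (ang ξ) v := by
  apply cj_injective (expT ξ)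
  rw [cj_cj_inv, cj_expT, rot_rot, neg_add_cancel, rot_zero]

theorem actX_expT_mk (ξ : Fin d → ℝ) {v : E d} (hv : v ≠ 0) :
    actX (expT ξ) (Projectivization.mk ℂ v hv) =
      Projectivization.mk ℂ (rot (-ang ξ) v) (rot_ne hv) := by
  rw [actX_mk _ v hv (by rw [cj_expT]; exact rot_ne hv)]
  exact mk_congr (cj_expT ξ v) _ _

theorem isometry_actX_expT (ξ : Fin d → ℝ) : Isometry (actX (expT ξ)) := by
  refine Isometry.of_dist_eq fun x y => ?_
  rw [← isometry_projEmb.dist_eq, ← isometry_projEmb.dist_eq x y]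
  let u : Fin (d + 1) → ℂ := fun j => Complex.exp (((-ang ξ) j : ℝ) * Complex.I)
  have key : ∀ (x : CP d) (ij), projEmb (actX (expT ξ) x) ij =
      (u ij.1 * (starRingEnd ℂ) (u ij.2)) * projEmb x ij := by
    intro x ij
    induction x using Projectivization.ind with
    | h v hv =>
      rw [actX_expT_mk ξ hv, projEmb_mk, projEmb_mk hv, norm_rot]
      simp only [rot_apply, map_mul, u]
      ring
  have hu : ∀ j, ‖u j‖ = 1 := fun j => Complex.norm_exp_ofReal_mul_I _
  rw [EuclideanSpace.dist_eq, EuclideanSpace.dist_eq]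
  congr 1
  refine Finset.sum_congr rfl fun ij _ => ?_
  rw [key, key, dist_eq_norm, dist_eq_norm, ← mul_sub, norm_mul, norm_mul, RCLike.norm_conj, hu, hu,
    one_mul, one_mul]

/-- The isometry of projective space given by an element of `T₀`. -/
def torusIso (ξ : Fin d → ℝ) : CP d ≃ᵢ CP d where
  toFun := actX (expT ξ)
  invFun := actX (expT ξ)⁻¹
  left_inv x := by rw [← actX_mul, inv_mul_cancel, actX_one]
  right_inv x := by rw [← actX_mul, mul_inv_cancel, actX_one]
  isometry_toFun := isometry_actX_expT ξ

theorem moment_actX_expT (ξ : Fin d → ℝ) (x : CP d) : moment (actX (expT ξ) x) = moment x := by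
  induction x using Projectivization.ind with
  | h v hv =>
    funext j
    rw [actX_expT_mk ξ hv, moment_mk, moment_mk, norm_rot, norm_rot_apply]

/-- The isometry of a fibre of the moment map given by an element of `T₀`. -/
def torusIsoLam (ν : Fin d → ℝ) (ξ : Fin d → ℝ) : Lam ν ≃ᵢ Lam ν where
  toFun y := ⟨actX (expT ξ) y, (moment_actX_expT ξ y.1).trans y.2⟩
  invFun y := ⟨actX (expT ξ)⁻¹ y, by
    have := moment_actX_expT ξ (actX (expT ξ)⁻¹ y)
    rw [actX_actX_inv] at this
    exact this.symm.trans y.2⟩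
  left_inv y := Subtype.ext (by
    change actX (expT ξ)⁻¹ (actX (expT ξ) y) = y
    rw [← actX_mul, inv_mul_cancel, actX_one])
  right_inv y := Subtype.ext (actX_actX_inv _ _)
  isometry_toFun := fun y y' => isometry_actX_expT ξ y.1 y'.1

theorem integral_comp_isometryEquiv {X : Type*} [MetricSpace X] [MeasurableSpace X] [BorelSpace X]
    (k : ℕ) (e : X ≃ᵢ X) (g : X → ℂ) :
    ∫ x, g (e x) ∂(μHE[k] : Measure X) = ∫ x, g x ∂(μHE[k] : Measure X) :=
  (e.measurePreserving_euclideanHausdorffMeasure k).integral_comp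
    e.toHomeomorph.measurableEmbedding g

theorem lift_secAct_expT (ξ : Fin d → ℝ) (s : Sec d m) (v : E d) :
    lift (secAct (expT ξ) s) v = lift s (rot (ang ξ) v) := by
  rw [lift_secAct, cj_expT_inv]

theorem lift_secAct_expT_inv (ξ : Fin d → ℝ) (s : Sec d m) (v : E d) :
    lift (secAct (expT ξ)⁻¹ s) v = lift s (rot (-ang ξ) v) := by
  rw [lift_secAct, inv_inv, cj_expT]

theorem herm_secAct_expT (ξ : Fin d → ℝ) (s t : Sec d m) (x : CP d) :
    herm (secAct (expT ξ) s (actX (expT ξ) x)) (t (actX (expT ξ) x)) =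
      herm (s x) (secAct (expT ξ)⁻¹ t x) := by
  induction x using Projectivization.ind with
  | h v hv =>
    rw [actX_expT_mk ξ hv, herm_lift, herm_lift, norm_rot, lift_secAct_expT, lift_secAct_expT_inv,
      rot_rot, add_neg_cancel, rot_zero]

theorem innerL2_secAct_expT (ξ : Fin d → ℝ) (s t : Sec d m) :
    innerL2 (secAct (expT ξ) s) t = innerL2 s (secAct (expT ξ)⁻¹ t) := by
  refine (integral_comp_isometryEquiv (2 * d) (torusIso ξ)
    fun x => herm (secAct (expT ξ) s x) (t x)).symm.trans ?_
  exact integral_congr_ae (Filter.Eventually.of_forall fun x => herm_secAct_expT ξ s t x)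

/-! ### Sections over a fibre of the moment map and their weights -/

/-- The character `e^ξ ↦ e^{2πi⟨ν, ξ⟩}`. -/
def chi (ν ξ : Fin d → ℝ) : ℂ :=
  Complex.exp (2 * Real.pi * Complex.I * ((∑ j, ν j * ξ j : ℝ) : ℂ))

theorem chi_mul_conj (ν ξ : Fin d → ℝ) : chi ν ξ * (starRingEnd ℂ) (chi ν ξ) = 1 := by
  rw [chi, ← Complex.exp_conj, ← Complex.exp_add]
  simp [Complex.conj_ofNat]

/-- A section over `Λ_ν` that is invariant under `T₀` has weight zero. -/
theorem liftOn_expT_of_invariant {ν : Fin d → ℝ} {f : SecOn m (Lam ν)} (hf : IsInvariantOn f)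
    (ξ : Fin d → ℝ) {w : E d} (hw : w ∈ cone (Lam ν)) :
    liftOn f (rot (ang ξ) w) = liftOn f w := by
  obtain ⟨h0, h⟩ := hw
  obtain ⟨h0', h'⟩ := rot_mem_Lam ⟨h0, h⟩ (ang ξ)
  have hact : actX (expT ξ) (Projectivization.mk ℂ _ h0') = Projectivization.mk ℂ w h0 := by
    rw [actX_expT_mk]
    exact mk_congr (by rw [rot_rot, neg_add_cancel, rot_zero]) _ _
  have := congrArg (fun φ => φ.1 w) (hf ξ ⟨_, h'⟩ ⟨_, h⟩ hact)
  rw [liftOn_of_mem f h0 h, liftOn_of_mem f h0' h', ← this]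
  change _ = (f ⟨_, h'⟩).1 (cj (expT ξ)⁻¹ w)
  rw [cj_expT_inv]

theorem IsSmoothOn.continuousOn {Y : Set (CP d)} {s : SecOn m Y} (hs : IsSmoothOn s) :
    ContinuousOn (liftOn s) (cone Y) := by
  intro v hv
  obtain ⟨W, hW, hvW, G, hG, hGs⟩ := hs v hv
  have h1 : ContinuousWithinAt G (cone Y) v :=
    (hG.continuousOn.continuousAt (hW.mem_nhds hvW)).continuousWithinAt
  refine h1.congr_of_eventuallyEq ?_ (hGs v ⟨hvW, hv⟩).symm
  filter_upwards [self_mem_nhdsWithin, mem_nhdsWithin_of_mem_nhds (hW.mem_nhds hvW)] with w hw hwW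
  exact (hGs w ⟨hwW, hw⟩).symm

theorem IsSmoothOn.differentiable_comp {Y : Set (CP d)} {s : SecOn m Y} (hs : IsSmoothOn s)
    {γ : ℝ → E d} (hγ : ContDiff ℝ ∞ γ) (hγY : ∀ t, γ t ∈ cone Y) :
    Differentiable ℝ fun t => liftOn s (γ t) := by
  intro t
  obtain ⟨W, hW, hvW, G, hG, hGs⟩ := hs _ (hγY t)
  have h1 : DifferentiableAt ℝ G (γ t) :=
    (hG.differentiableOn (by norm_num)).differentiableAt (hW.mem_nhds hvW)
  have h2 : DifferentiableAt ℝ γ t := (hγ.differentiable (by norm_num)) t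
  refine (h1.comp t h2).congr_of_eventuallyEq ?_
  filter_upwards [hγ.continuous.continuousAt.preimage_mem_nhds (hW.mem_nhds hvW)] with τ hτ
  exact (hGs _ ⟨hτ, hγY τ⟩).symm

theorem hasDerivAt_rot_smul (θ : Fin (d + 1) → ℝ) (w : E d) (t : ℝ) :
    HasDerivAt (fun t : ℝ => rot (t • θ) w)
      (WithLp.toLp 2 fun j => Complex.I * (θ j : ℂ) * rot (t • θ) w j) t := by
  let L := (PiLp.continuousLinearEquiv 2 ℝ fun _ : Fin (d + 1) => ℂ).symm
  refine L.hasFDerivAt.comp_hasDerivAt t (hasDerivAt_pi.2 fun j => ?_)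
  simp only [rot_apply, Pi.smul_apply, smul_eq_mul]
  have h1 : HasDerivAt (fun t : ℝ => ((t * θ j : ℝ) : ℂ) * Complex.I)
      ((θ j : ℂ) * Complex.I) t := by
    have := ((hasDerivAt_id t).mul_const (θ j)).ofReal_comp.mul_const Complex.I
    simpa using this
  exact ((h1.cexp).const_mul (w j)).congr_deriv (by ring)

/-- The connection form of `L` along an orbit of a one-parameter subgroup of `T₀` is constant, with
value given by the moment map. -/
theorem inner_rot_deriv {ν : Fin d → ℝ} {w : E d} (hw : w ∈ cone (Lam ν)) (ξ : Fin d → ℝ) :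
    inner ℂ w (WithLp.toLp 2 fun j => Complex.I * (ang ξ j : ℂ) * w j : E d) /
      ((‖w‖ ^ 2 : ℝ) : ℂ) = 2 * Real.pi * Complex.I * ((∑ j, ν j * ξ j : ℝ) : ℂ) := by
  obtain ⟨h0, h⟩ := hw
  rw [mk_mem_Lam] at h
  have hn : ((‖w‖ ^ 2 : ℝ) : ℂ) ≠ 0 :=
    Complex.ofReal_ne_zero.2 (pow_ne_zero 2 (norm_ne_zero_iff.2 h0))
  rw [div_eq_iff hn, PiLp.inner_apply]
  have h1 : ∀ j, inner ℂ (w j) (Complex.I * (ang ξ j : ℂ) * w j) =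
      Complex.I * ((ang ξ j * (bary ν j * ‖w‖ ^ 2) : ℝ) : ℂ) := by
    intro j
    rw [← h, RCLike.inner_apply, mul_assoc, Complex.mul_conj, Complex.normSq_eq_norm_sq]
    push_cast
    ring
  simp only [h1]
  rw [← Finset.mul_sum, ← Complex.ofReal_sum, Fin.sum_univ_succ]
  simp only [ang, bary, Fin.cons_zero, Fin.cons_succ, mul_zero, zero_mul, zero_add]
  rw [show ∑ j, 2 * Real.pi * ξ j * (ν j * ‖w‖ ^ 2) =
    2 * Real.pi * (∑ j, ν j * ξ j) * ‖w‖ ^ 2 by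
      rw [Finset.mul_sum, Finset.sum_mul]
      exact Finset.sum_congr rfl fun j _ => by ring]
  push_cast
  ring

/-- A flat section of `L^p` over `Λ_ν` has weight `pν`: along the orbits of one-parameter subgroups
of `T₀`, flatness is a linear differential equation with constant coefficients. -/
theorem liftOn_expT_of_flat {p : ℕ} {ν : Fin d → ℝ} {ζ : SecOn (p : ℤ) (Lam ν)}
    (hζ : IsSmoothOn ζ) (hflat : IsFlatOn ζ) (ξ : Fin d → ℝ) {w : E d} (hw : w ∈ cone (Lam ν)) :
    liftOn ζ (rot (ang ξ) w) = chi ((p : ℝ) • ν) ξ * liftOn ζ w := by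
  set γ : ℝ → E d := fun t => rot (t • ang ξ) w with hγdef
  have hγ : ContDiff ℝ ∞ γ := (contDiff_rot w).comp (contDiff_id.smul contDiff_const)
  have hγY : ∀ t, γ t ∈ cone (Lam ν) := fun t => rot_mem_Lam hw _
  set c : ℂ := 2 * Real.pi * Complex.I * ((∑ j, ((p : ℝ) • ν) j * ξ j : ℝ) : ℂ) with hc
  have hdiff := hζ.differentiable_comp hγ hγY
  have hode : ∀ t, deriv (fun t => liftOn ζ (γ t)) t = c * liftOn ζ (γ t) := by
    intro t
    have h1 := hflat γ hγ hγY t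
    rw [covDeriv, (hasDerivAt_rot_smul (ang ξ) w t).deriv, inner_rot_deriv (hγY t),
      sub_eq_zero] at h1
    rw [h1, hc]
    congr 1
    simp only [Pi.smul_apply, smul_eq_mul, mul_assoc, ← Finset.mul_sum]
    push_cast
    ring
  have hconst : ∀ t, HasDerivAt (fun t : ℝ => Complex.exp (-(c * t)) * liftOn ζ (γ t)) 0 t := by
    intro t
    have h1 : HasDerivAt (fun t : ℝ => -(c * (t : ℂ))) (-c) t := by
      simpa using ((hasDerivAt_id t).ofReal_comp.const_mul c).fun_neg
    have h2 := h1.cexp.fun_mul (hdiff t).hasDerivAt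
    rw [hode] at h2
    exact h2.congr_deriv (by ring)
  have h := is_const_of_deriv_eq_zero (fun t => (hconst t).differentiableAt)
    (fun t => (hconst t).deriv) 1 0
  simp only [hγdef, one_smul, zero_smul, rot_zero, Complex.ofReal_one, Complex.ofReal_zero, mul_one,
    mul_zero, neg_zero, Complex.exp_zero, one_mul] at h
  rw [← h, chi, ← hc, ← mul_assoc, ← Complex.exp_add, add_neg_cancel, Complex.exp_zero, one_mul]

theorem continuous_herm_on {Y : Set (CP d)} (hY : IsClosed Y) {τ : SecOn m Y}
    (hτ : ContinuousOn (liftOn τ) (cone Y)) {t : Sec d m} (ht : ContinuousOn (lift t) {0}ᶜ) :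
    Continuous fun y : Y => herm (τ y) (t y) := by
  refine continuous_of_cone hY (h := fun v => liftOn τ v * (starRingEnd ℂ) (lift t v) /
    ((‖v‖ ^ (2 * m) : ℝ) : ℂ)) ?_ fun v hv hy => ?_
  · have hsub : cone Y ⊆ {0}ᶜ := fun v hv => hv.choose
    exact (hτ.mul (Complex.continuous_conj.comp_continuousOn (ht.mono hsub))).div
      ((continuousOn_norm_zpow _).mono hsub) fun v hv => norm_zpow_ne hv.choose _
  · rw [herm_eq hv rfl, liftOn_of_mem τ hv hy, lift_of_ne t hv]

theorem integrable_herm_on {ν : Fin d → ℝ} {τ : SecOn m (Lam ν)}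
    (hτ : ContinuousOn (liftOn τ) (cone (Lam ν))) {t : Sec d m} (ht : t ∈ H0 d m) :
    Integrable (fun y : Lam ν => herm (τ y) (t y)) (volLam ν) := by
  have : CompactSpace (Lam ν) := isCompact_iff_compactSpace.1 (isClosed_Lam ν).isCompact
  exact (continuous_herm_on (isClosed_Lam ν) hτ
    (H0.continuousOn ht)).integrable_of_hasCompactSupport (HasCompactSupport.of_compactSpace _)

/-- The section `τ` over `Λ_ν` is a weight vector of weight `κ` for `T₀`. -/
def HasWeightOn {ν : Fin d → ℝ} (τ : SecOn m (Lam ν)) (κ : Fin d → ℝ) : Prop :=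
  ∀ (ξ : Fin d → ℝ) (w : E d), w ∈ cone (Lam ν) →
    liftOn τ (rot (ang ξ) w) = chi κ ξ * liftOn τ w

/-- The pairing of a weight vector over `Λ_ν` with sections over `X` is equivariant, as `T₀` acts on
`Λ_ν` by isometries. -/
theorem HasWeightOn.integral_secAct {ν κ : Fin d → ℝ} {τ : SecOn m (Lam ν)} (hτ : HasWeightOn τ κ)
    (ξ : Fin d → ℝ) (t : Sec d m) :
    ∫ y, herm (τ y) (secAct (expT ξ)⁻¹ t y) ∂(volLam ν) =
      chi κ ξ * ∫ y, herm (τ y) (t y) ∂(volLam ν) := by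
  rw [volLam, ← integral_comp_isometryEquiv (dimLam ν) (torusIsoLam ν ξ)
    fun y => herm (τ y) (t y), ← integral_const_mul]
  congr 1
  funext y
  obtain ⟨y, hy⟩ := y
  induction y using Projectivization.ind with
  | h v hv =>
    have hm := rot_mem_Lam ⟨hv, hy⟩ (-ang ξ)
    have e : torusIsoLam ν ξ ⟨_, hy⟩ = ⟨Projectivization.mk ℂ _ hm.choose, hm.choose_spec⟩ :=
      Subtype.ext (actX_expT_mk ξ hv)
    rw [e, herm_eq hv rfl, herm_eq hm.choose rfl, ← liftOn_of_mem τ hv hy,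
      ← liftOn_of_mem τ hm.choose hm.choose_spec, ← lift_of_ne _ hv, ← lift_of_ne _ hm.choose,
      norm_rot, lift_secAct_expT_inv]
    have := hτ ξ _ hm
    rw [rot_rot, add_neg_cancel, rot_zero] at this
    rw [this]
    ring

/-- A nonzero weight vector over the orbit `Λ_ν` vanishes nowhere. -/
theorem HasWeightOn.ne_zero {ν κ : Fin d → ℝ} {τ : SecOn m (Lam ν)} (hτ : HasWeightOn τ κ)
    (h0 : τ ≠ 0) {z : E d} (hz : ‖z‖ = 1) (hzL : z ∈ cone (Lam ν)) : liftOn τ z ≠ 0 := by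
  intro h
  apply h0
  funext y
  obtain ⟨y, hy⟩ := y
  obtain ⟨θ, hθ, -, -, hne, rfl⟩ := exists_rot hz hzL 0 hy
  obtain ⟨ξ, rfl⟩ := exists_ang hθ
  refine Fib.ext_mk hne ?_
  rw [← liftOn_of_mem τ hne hy, hτ ξ z hzL, h, mul_zero]
  rfl

theorem liftOn_tensor {a b : ℤ} {Y : Set (CP d)} (ζ : SecOn a Y) (f : SecOn b Y) (v : E d) :
    liftOn (fun y => tensor (ζ y) (f y)) v = liftOn ζ v * liftOn f v := by
  by_cases h : v ∈ cone Y
  · obtain ⟨h0, h⟩ := h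
    rw [liftOn_of_mem _ h0 h, liftOn_of_mem _ h0 h, liftOn_of_mem _ h0 h]
    rfl
  · have h' : ¬∃ hv : v ≠ 0, Projectivization.mk ℂ v hv ∈ Y := h
    simp [liftOn, h']

theorem weightSpace_iff {u : H0 d m} {κ : Fin d → ℝ} :
    u ∈ weightSpace (V d m) κ ↔ ∀ ξ, secAct (expT ξ) u.1 = chi κ ξ • u.1 :=
  ⟨fun h ξ => congrArg Subtype.val (h ξ), fun h ξ => Subtype.ext (h ξ)⟩

/-- If a weight vector `τ` over `Λ_ν` pairs to zero with a weight vector of the same weight in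
`H⁰(X, L^m)`, then their product vanishes, as it is constant on the orbit `Λ_ν`. -/
theorem HasWeightOn.mul_eq_zero_of_integral {ν κ : Fin d → ℝ} {τ : SecOn m (Lam ν)}
    (hτ : HasWeightOn τ κ) {u : Sec d m} (hu : ∀ ξ, secAct (expT ξ) u = chi κ ξ • u)
    (hint : ∫ y, herm (τ y) (u y) ∂(volLam ν) = 0) {z : E d} (hz : ‖z‖ = 1)
    (hzL : z ∈ cone (Lam ν)) : liftOn τ z * (starRingEnd ℂ) (lift u z) = 0 := by
  have hconst : ∀ y : Lam ν, herm (τ y) (u y) = liftOn τ z * (starRingEnd ℂ) (lift u z) := by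
    rintro ⟨y, hy⟩
    obtain ⟨θ, hθ, -, -, hne, rfl⟩ := exists_rot hz hzL 0 hy
    obtain ⟨ξ, rfl⟩ := exists_ang hθ
    rw [herm_eq hne rfl, ← liftOn_of_mem τ hne hy, ← lift_of_ne u hne, hτ ξ z hzL,
      ← lift_secAct_expT, hu, lift_const_smul, norm_rot, hz, one_zpow, Complex.ofReal_one, div_one,
      map_mul, mul_mul_mul_comm, chi_mul_conj, one_mul]
  simp_rw [hconst] at hint
  rw [integral_const, smul_eq_zero] at hint
  refine hint.resolve_left ?_
  rw [measureReal_def, ENNReal.toReal_eq_zero_iff, not_or]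
  exact ⟨volLam_ne_zero ⟨_, hzL.choose_spec⟩, measure_ne_top _ _⟩

/-! ### Nonvanishing of weight vectors -/

/-- Coordinatewise multiplication. -/
def dil (t : Fin (d + 1) → ℂ) (w : E d) : E d := WithLp.toLp 2 fun j => t j * w j

@[simp] theorem dil_apply (t : Fin (d + 1) → ℂ) (w : E d) (j : Fin (d + 1)) :
    dil t w j = t j * w j := rfl

theorem dil_ne {t : Fin (d + 1) → ℂ} (ht : ∀ j, t j ≠ 0) {w : E d} (hw : w ≠ 0) : dil t w ≠ 0 := by
  intro h
  apply hw
  ext j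
  have := congrArg (fun u : E d => u j) h
  simpa [ht j] using this

theorem cons_one_ne {s : Fin d → ℂ} (hs : ∀ j, s j ≠ 0) (j : Fin (d + 1)) :
    (Fin.cons 1 s : Fin (d + 1) → ℂ) j ≠ 0 := by
  refine Fin.cases ?_ (fun j => ?_) j
  · simp
  · simpa using hs j

/-- The vectors with the vanishing coordinates of `z` replaced by `ε`. -/
def fillz (z : E d) (ε : ℂ) : E d := WithLp.toLp 2 fun j => open Classical in
  if z j = 0 then ε else z j

theorem fillz_zero (z : E d) : fillz z 0 = z := by
  ext j
  by_cases h : z j = 0 <;> simp [fillz, h]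

theorem fillz_ne (z : E d) {ε : ℂ} (hε : ε ≠ 0) (j : Fin (d + 1)) : fillz z ε j ≠ 0 := by
  by_cases h : z j = 0 <;> simp [fillz, h, hε]

theorem continuous_fillz (z : E d) : Continuous (fillz z) := by
  refine (PiLp.continuous_toLp 2 _).comp (continuous_pi fun j => ?_)
  by_cases h : z j = 0
  · simpa [h] using continuous_id'
  · simpa [h] using continuous_const

theorem ne_zero_of_coord_ne {w : E d} (hw : ∀ j, w j ≠ 0) : w ≠ 0 := fun h => hw 0 (by simp [h])

/-- A function that transforms by a character of the complex torus, and that vanishes at a point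
`z` such that the exponents of the vanishing coordinates of `z` are nonpositive, is zero. -/
theorem eq_zero_of_dil {F : E d → ℂ} (hF : ContinuousOn F {0}ᶜ) {a : Fin (d + 1) → ℤ}
    (hdil : ∀ t : Fin (d + 1) → ℂ, (∀ j, t j ≠ 0) → ∀ w, w ≠ 0 →
      F (dil t w) = (∏ j, t j ^ a j) * F w)
    {z : E d} (hz : z ≠ 0) (ha : ∀ j, z j = 0 → a j ≤ 0) (hFz : F z = 0) {w : E d} (hw : w ≠ 0) :
    F w = 0 := by
  have hlim : ∀ z : E d, z ≠ 0 →
      Filter.Tendsto (fun ε => F (fillz z ε)) (nhdsWithin 0 {0}ᶜ) (nhds (F z)) := by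
    intro z hz
    have h1 : ContinuousAt F (fillz z 0) := by
      rw [fillz_zero]
      exact hF.continuousAt (isOpen_compl_zero.mem_nhds hz)
    have h2 := (ContinuousAt.comp (f := fillz z) h1 (continuous_fillz z).continuousAt).tendsto
    simp only [Function.comp_apply, fillz_zero] at h2
    exact h2.mono_left nhdsWithin_le_nhds
  have hgen : ∀ w : E d, (∀ j, w j ≠ 0) → F w = 0 := by
    intro w hw
    -- `F w` is `F (fillz z ε)` times a product of factors, each of which is constant in `ε` or a
    -- nonnegative power of it; so the limit `ε → 0` may be taken.
    let G : Fin (d + 1) → ℂ → ℂ := fun j ε => open Classical in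
      if z j = 0 then (ε / w j) ^ (-a j).toNat else (w j / z j) ^ a j
    have hG : ∀ j, Continuous (G j) := fun j => by
      by_cases h : z j = 0
      · simp only [G, h, if_true]
        exact (continuous_id.div_const _).pow _
      · simp only [G, h, if_false]
        exact continuous_const
    have heq : ∀ ε : ℂ, ε ≠ 0 → (∏ j, G j ε) * F (fillz z ε) = F w := by
      intro ε hε
      have h1 : w = dil (fun j => w j / fillz z ε j) (fillz z ε) := by
        ext j
        rw [dil_apply, div_mul_cancel₀ _ (fillz_ne z hε j)]
      conv_rhs => rw [h1]
      rw [hdil _ (fun j => div_ne_zero (hw j) (fillz_ne z hε j)) _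
        (ne_zero_of_coord_ne (fillz_ne z hε))]
      congr 1
      refine Finset.prod_congr rfl fun j _ => ?_
      by_cases h : z j = 0
      · simp only [G, fillz, h, if_true]
        rw [← zpow_natCast, Int.toNat_of_nonneg (neg_nonneg.2 (ha j h)), zpow_neg, ← inv_zpow,
          inv_div]
      · simp only [G, fillz, h, if_false]
    have h1 : Filter.Tendsto (fun ε => (∏ j, G j ε) * F (fillz z ε)) (nhdsWithin 0 {0}ᶜ)
        (nhds ((∏ j, G j 0) * F z)) :=
      ((continuous_finsetProd _ fun j _ => hG j).continuousAt.tendsto.mono_left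
        nhdsWithin_le_nhds).mul (hlim z hz)
    have h2 : Filter.Tendsto (fun ε => (∏ j, G j ε) * F (fillz z ε)) (nhdsWithin 0 {0}ᶜ)
        (nhds (F w)) := by
      refine tendsto_const_nhds.congr' ?_
      filter_upwards [self_mem_nhdsWithin] with ε hε
      exact (heq ε hε).symm
    rw [tendsto_nhds_unique h2 h1, hFz, mul_zero]
  refine tendsto_nhds_unique (hlim w hw) (tendsto_const_nhds.congr' ?_)
  filter_upwards [self_mem_nhdsWithin] with ε hε
  exact (hgen _ (fillz_ne w hε)).symm

/-- A holomorphic function on `ℂ ∖ {0}` is determined by its values on the unit circle. -/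
theorem eq_of_eq_on_circle {f g : ℂ → ℂ} (hf : DifferentiableOn ℂ f {0}ᶜ)
    (hg : DifferentiableOn ℂ g {0}ᶜ) (h : ∀ t : ℝ, f (Complex.exp (t * Complex.I)) =
      g (Complex.exp (t * Complex.I))) {z : ℂ} (hz : z ≠ 0) : f z = g z := by
  have ho : IsOpen ({0}ᶜ : Set ℂ) := isOpen_compl_singleton
  have hpre : IsPreconnected ({0}ᶜ : Set ℂ) :=
    (isConnected_compl_singleton_of_one_lt_rank (by simp) 0).isPreconnected
  refine (hf.analyticOnNhd ho).eqOn_of_preconnected_of_frequently_eq (hg.analyticOnNhd ho) hpre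
    (z₀ := 1) (by simp) ?_ hz
  have hd : HasDerivAt (fun t : ℝ => Complex.exp (t * Complex.I)) Complex.I 0 := by
    have h1 : HasDerivAt (fun t : ℝ => (t : ℂ) * Complex.I) Complex.I 0 := by
      simpa using (hasDerivAt_id (0 : ℝ)).ofReal_comp.mul_const Complex.I
    simpa using h1.cexp
  have ht := hd.tendsto_nhdsNE Complex.I_ne_zero
  simp only [Complex.ofReal_zero, zero_mul, Complex.exp_zero] at ht
  exact ht.frequently (Filter.Eventually.of_forall h).frequently

/-- The transformation rule of a weight vector under one factor of the complex torus, by analytic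
continuation from the unit circle. -/
theorem lift_dil_single {s : Sec d m} (hs : s ∈ H0 d m) {a : Fin d → ℤ}
    (hw : ∀ (ξ : Fin d → ℝ) (w : E d), lift s (rot (ang ξ) w) = chi (fun j => a j) ξ * lift s w)
    (i : Fin d) {t : ℂ} (ht : t ≠ 0) {w : E d} (hw0 : w ≠ 0) :
    lift s (dil (Fin.cons 1 (Function.update 1 i t)) w) = t ^ a i * lift s w := by
  have hne : ∀ t : ℂ, t ≠ 0 → dil (Fin.cons 1 (Function.update 1 i t)) w ≠ 0 := fun t ht =>
    dil_ne (cons_one_ne fun j => by by_cases h : j = i <;> simp [h, ht]) hw0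
  refine eq_of_eq_on_circle (f := fun t => lift s (dil (Fin.cons 1 (Function.update 1 i t)) w))
    (g := fun t => t ^ a i * lift s w) ?_ ?_ ?_ ht
  · intro t ht
    have h1 : DifferentiableAt ℂ
        (fun t : ℂ => dil (Fin.cons 1 (Function.update (1 : Fin d → ℂ) i t)) w) t := by
      rw [differentiableAt_piLp]
      intro j
      refine Fin.cases ?_ (fun j => ?_) j
      · simp only [dil_apply, Fin.cons_zero]
        exact differentiableAt_const _
      · by_cases h : j = i
        · subst h; simp
        · simp [h]
    exact (DifferentiableAt.comp (g := lift s) t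
      (H0.differentiableAt hs (hne t ht)) h1).differentiableWithinAt
  · intro t ht
    exact ((differentiableAt_zpow.2 (Or.inl ht)).mul_const _).differentiableWithinAt
  · intro t
    have h1 : dil (Fin.cons 1 (Function.update 1 i (Complex.exp (t * Complex.I)))) w =
        rot (ang (Pi.single i (t / (2 * Real.pi)))) w := by
      ext j
      rw [dil_apply, rot_apply, mul_comm]
      congr 1
      refine Fin.cases ?_ (fun j => ?_) j
      · simp [ang]
      · by_cases h : j = i
        · subst h
          simp only [ang, Fin.cons_succ, Function.update_self, Pi.single_eq_same]
          congr 3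
          field_simp
        · simp [ang, h]
    simp only [h1]
    rw [hw]
    congr 1
    rw [chi, ← Complex.exp_int_mul]
    congr 1
    simp only [Pi.single_apply, mul_ite, mul_zero, Finset.sum_ite_eq', Finset.mem_univ, if_true]
    have : (Real.pi : ℂ) ≠ 0 := Complex.ofReal_ne_zero.2 Real.pi_ne_zero
    push_cast
    field_simp

/-- A weight vector in `H⁰(X, L^m)` transforms by a character of the complex torus. The exponent of
the first coordinate comes from homogeneity, as `T₀` does not act on that coordinate. -/
theorem lift_dil {s : Sec d m} (hs : s ∈ H0 d m) {a : Fin d → ℤ}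
    (hw : ∀ (ξ : Fin d → ℝ) (w : E d), lift s (rot (ang ξ) w) = chi (fun j => a j) ξ * lift s w)
    {t : Fin (d + 1) → ℂ} (ht : ∀ j, t j ≠ 0) {w : E d} (hw0 : w ≠ 0) :
    lift s (dil t w) =
      (∏ j, t j ^ (Fin.cons (m - ∑ i, a i) a : Fin (d + 1) → ℤ) j) * lift s w := by
  have hS : ∀ (x : Fin d → ℂ), (∀ j, x j ≠ 0) → ∀ S : Finset (Fin d),
      lift s (dil (Fin.cons 1 (S.piecewise x 1)) w) = (∏ j ∈ S, x j ^ a j) * lift s w := by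
    intro x hx S
    induction S using Finset.induction_on with
    | empty =>
      have : dil (Fin.cons 1 ((∅ : Finset (Fin d)).piecewise x 1)) w = w := by
        ext j
        refine Fin.cases ?_ (fun j => ?_) j <;> simp
      rw [this, Finset.prod_empty, one_mul]
    | insert i S hi ih =>
      have h1 : dil (Fin.cons 1 ((insert i S).piecewise x 1)) w =
          dil (Fin.cons 1 (Function.update 1 i (x i))) (dil (Fin.cons 1 (S.piecewise x 1)) w) := by
        ext j
        refine Fin.cases ?_ (fun j => ?_) j
        · simp only [dil_apply, Fin.cons_zero, one_mul]
        · by_cases h : j = i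
          · subst h; simp [hi]
          · simp [h, Finset.piecewise_insert]
      rw [h1, lift_dil_single hs hw i (hx i), ih, Finset.prod_insert hi, mul_assoc]
      refine dil_ne (cons_one_ne fun j => ?_) hw0
      by_cases h : j ∈ S <;> simp [h, hx j]
  have h1 : dil t w =
      t 0 • dil (Fin.cons 1 (Finset.univ.piecewise (fun j => t j.succ / t 0) 1)) w := by
    ext j
    refine Fin.cases ?_ (fun j => ?_) j
    · simp
    · simp only [dil_apply, PiLp.smul_apply, Fin.cons_succ, Finset.piecewise_univ, smul_eq_mul]
      rw [← mul_assoc, mul_div_cancel₀ _ (ht 0)]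
  have h2 : ∀ S : Finset (Fin d), ∏ j ∈ S, t 0 ^ a j = t 0 ^ (∑ j ∈ S, a j) := by
    intro S
    induction S using Finset.induction_on with
    | empty => simp
    | insert i S hi ih => rw [Finset.prod_insert hi, Finset.sum_insert hi, zpow_add₀ (ht 0), ih]
  rw [h1, lift_smul s (ht 0), hS _ (fun j => div_ne_zero (ht _) (ht 0)), Fin.prod_univ_succ]
  simp only [Fin.cons_zero, Fin.cons_succ, div_zpow, Finset.prod_div_distrib, h2]
  rw [zpow_sub₀ (ht 0)]
  ring

/-- A nonzero weight vector of weight `pν` in `H⁰(X, L^m)`, for `m ≤ p`, vanishes nowhere on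
`Λ_ν`. -/
theorem lift_ne_zero_of_weight {ν : Fin d → ℝ} {p : ℕ} (hm : m ≤ p) {s : Sec d m}
    (hs : s ∈ H0 d m) (hs0 : s ≠ 0) (hint : ∀ j, ∃ a : ℤ, ((p : ℝ) • ν) j = a)
    (hw : ∀ ξ, secAct (expT ξ) s = chi ((p : ℝ) • ν) ξ • s)
    {z : E d} (hz : z ∈ cone (Lam ν)) : lift s z ≠ 0 := by
  choose a ha using hint
  intro h0
  refine hs0 (sec_ext fun w hw0 => ?_)
  rw [lift_zero]
  have hκ : ((p : ℝ) • ν) = fun j => (a j : ℝ) := funext ha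
  refine eq_zero_of_dil (H0.continuousOn hs)
    (a := Fin.cons (m - ∑ i, a i) a) (fun t ht w hw0 => lift_dil hs (fun ξ w => ?_) ht hw0)
    hz.choose (fun j hj => ?_) h0 hw0
  · rw [← hκ, ← lift_secAct_expT, hw, lift_const_smul]
  · rw [← bary_eq_zero_iff hz] at hj
    revert hj
    refine Fin.cases ?_ (fun j => ?_) j
    · -- If the first coordinate vanishes on `Λ_ν`, then `∑ pν_j = p ≥ m`.
      intro hj
      simp only [bary, Fin.cons_zero] at hj ⊢
      have h1 : ((∑ i, a i : ℤ) : ℝ) = p := by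
        push_cast
        simp_rw [← ha, Pi.smul_apply, smul_eq_mul]
        rw [← Finset.mul_sum, ← sub_eq_zero.1 hj, mul_one]
      have h2 : ∑ i, a i = p := by exact_mod_cast h1
      omega
    · intro hj
      simp only [bary, Fin.cons_succ] at hj ⊢
      have := ha j
      rw [Pi.smul_apply, hj, smul_zero] at this
      exact le_of_eq (by exact_mod_cast this.symm)

end CPQuant

end

theorem proposition4p3 (d : ℕ) (p k : ℕ) (hp : 0 < p) (v : Fin d → ℝ)
    (hv : (p : ℝ) • v ∈ CPQuant.weights (CPQuant.V d ((p : ℤ) + -(k : ℤ))))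
    (f : CPQuant.SecOn (-(k : ℤ)) (CPQuant.Lam v))
    (hf : CPQuant.IsSmoothOn f) (hf_inv : CPQuant.IsInvariantOn f)
    (ζ : CPQuant.SecOn (p : ℤ) (CPQuant.Lam v))
    (hζ : CPQuant.IsSmoothOn ζ) (hζ_flat : CPQuant.IsFlatOn ζ) :
    (∀ (x : CPQuant.CP d) (w : CPQuant.E d),
      MeasureTheory.Integrable (fun y : CPQuant.Lam v =>
        (CPQuant.bergman d ((p : ℤ) + -(k : ℤ)) x y (CPQuant.tensor (ζ y) (f y))).1 w)
        (CPQuant.volLam v)) ∧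
    (∃ hs : CPQuant.isoState ζ f ∈ CPQuant.H0 d ((p : ℤ) + -(k : ℤ)),
      (⟨CPQuant.isoState ζ f, hs⟩ : CPQuant.H0 d ((p : ℤ) + -(k : ℤ))) ∈
        CPQuant.weightSpace (CPQuant.V d ((p : ℤ) + -(k : ℤ))) ((p : ℝ) • v)) ∧
    (ζ ≠ 0 → f ≠ 0 → CPQuant.isoState ζ f ≠ 0) := by
  open CPQuant in
  obtain ⟨n, e, he⟩ := exists_isFrame d ((p : ℤ) + -(k : ℤ))
  let τ : SecOn ((p : ℤ) + -(k : ℤ)) (Lam v) := fun y => tensor (ζ y) (f y)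
  have hlift : ∀ w, liftOn τ w = liftOn ζ w * liftOn f w := liftOn_tensor ζ f
  have hτc : ContinuousOn (liftOn τ) (cone (Lam v)) := by
    rw [show liftOn τ = fun w => liftOn ζ w * liftOn f w from funext hlift]
    exact hζ.continuousOn.mul hf.continuousOn
  have hζw : HasWeightOn ζ ((p : ℝ) • v) := fun ξ w hw => liftOn_expT_of_flat hζ hζ_flat ξ hw
  have hfw : HasWeightOn f 0 := fun ξ w hw => by
    rw [liftOn_expT_of_invariant hf_inv ξ hw]
    simp [chi]
  have hτw : HasWeightOn τ ((p : ℝ) • v) := fun ξ w hw => by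
    rw [hlift, hlift, hζw ξ w hw, liftOn_expT_of_invariant hf_inv ξ hw, mul_assoc]
  have hint : ∀ i, Integrable (fun y : Lam v => herm (τ y) (e i y)) (volLam v) := fun i =>
    integrable_herm_on hτc (he.mem i)
  have hiso : isoState ζ f = ∑ i, (∫ y, herm (τ y) (e i y) ∂(volLam v)) • e i := by
    funext x
    rw [isoState, bergman_eq_frameKer he]
    exact fibIntegral_frameKer e (volLam v) Subtype.val τ hint x
  have hpair : ∀ t ∈ H0 d ((p : ℤ) + -(k : ℤ)),
      innerL2 (isoState ζ f) t = ∫ y, herm (τ y) (t y) ∂(volLam v) := fun t ht => by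
    rw [hiso]
    exact innerL2_frame he (volLam v) Subtype.val τ hint ht
  have hmem : isoState ζ f ∈ H0 d ((p : ℤ) + -(k : ℤ)) := by
    rw [hiso]
    exact Submodule.sum_mem _ fun i _ => Submodule.smul_mem _ _ (he.mem i)
  refine ⟨fun x w => ?_, ⟨hmem, weightSpace_iff.2 fun ξ => ?_⟩, fun hζ0 hf0 hs0 => ?_⟩
  · rw [bergman_eq_frameKer he]
    simp_rw [frameKer_apply_val]
    exact integrable_finsetSum _ fun i _ => (hint i).mul_const _
  · -- The difference of the two sides is orthogonal to `H⁰(X, L^{p-k})`, so to itself.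
    have h1 := secAct_mem (expT ξ) _ hmem
    have h2 := (H0 d ((p : ℤ) + -(k : ℤ))).smul_mem (-chi ((p : ℝ) • v) ξ) hmem
    have h3 := (H0 d ((p : ℤ) + -(k : ℤ))).add_mem h1 h2
    have h4 := eq_zero_of_innerL2_self (H0.continuousOn h3) (by
      rw [innerL2_add_left (H0.continuousOn h1) (H0.continuousOn h2) (H0.continuousOn h3),
        innerL2_smul_left, innerL2_secAct_expT, hpair _ (secAct_mem _ _ h3), hpair _ h3,
        hτw.integral_secAct]
      ring)
    rw [neg_smul] at h4
    exact add_neg_eq_zero.1 h4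
  · obtain ⟨hv_int, hv_ne⟩ := hv
    obtain ⟨u, hu, hu0⟩ := (Submodule.ne_bot_iff _).1 hv_ne
    obtain ⟨y, hy⟩ : ∃ y, ζ y ≠ 0 := by
      by_contra h
      push Not at h
      exact hζ0 (funext h)
    obtain ⟨z, hz, hzL⟩ := exists_unit_mem_cone ⟨y.1, y.2⟩
    have hI : ∫ y, herm (τ y) (u.1 y) ∂(volLam v) = 0 := by
      rw [← hpair u.1 u.2, hs0]
      simpa using innerL2_smul_left 0 (0 : Sec d ((p : ℤ) + -(k : ℤ))) u.1
    have hu' := weightSpace_iff.1 hu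
    have h := hτw.mul_eq_zero_of_integral hu' hI hz hzL
    rw [hlift, mul_eq_zero, mul_eq_zero] at h
    rcases h with (h | h) | h
    · exact hζw.ne_zero hζ0 hz hzL h
    · exact hfw.ne_zero hf0 hz hzL h
    · refine lift_ne_zero_of_weight (by omega) u.2 (fun h => hu0 (Subtype.ext h)) hv_int hu' hzL ?_
      simpa using h
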